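/- Let $n\ge 1$ and let $V$ be a real vector space of dimension $n+1$ with a nondegenerate quadratic form $Q$ of signature $(n,1)$ and associated symmetric bilinear form $\langle\cdot,\cdot\rangle$, $Q(x)=\langle x,x\rangle$. Extend $\langle\cdot,\cdot\rangle$ to $\bigwedge^n V$ by $\langle v_1\wedge\dots\wedge v_n,\,w_1\wedge\dots\wedge w_n\rangle=\det(\langle v_i,w_j\rangle)$, and put $Q(\omega)=\langle\omega,\omega\rangle$. Let $H^+=\{x\in V: Q(x)=1\}$. A *neck* is a compact $(n-1)$-dimensional embedded $C^1$ submanifold $N$ of $V$ without boundary such that $N\subset H^+$, every nonzero tangent vector $v$ of $N$ is spacelike (that is, $Q(v)>0$), and the inclusion $N\hookrightarrow H^+$ is a homotopy equivalence. At each $x\in N$ the span of $x$ and $T_xN$ is a spacelike $n$-plane (one on which $Q$ is positive definite), and $N$ is given the orientation induced, with the position vector $x$ placed first, by a consistent orientation of all spacelike $n$-planes in $V$ (there are two such choices, which differ by a global sign). The *directed volume* of an oriented $n$-dimensional piece parametrized by $f:U\subset\mathbb{R}^n\to V$ is $\int_U \partial_1 f\wedge\dots\wedge\partial_n f\,ds\in\bigwedge^n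 V$, and the directed volume $\overrightarrow{\mathrm{Vol}}\,N\in\bigwedge^n V$ enclosed by $N$ is the directed volume of the oriented cone over $N$ with apex $0$, computed by cutting $N$ into finitely many disjoint oriented parametrized pieces. Let $v_n$ be the volume of the unit ball of Euclidean $\mathbb{R}^n$. Then for every spacelike $n$-dimensional linear subspace $W\subset V$ the set $W\cap H^+$ is a neck. Moreover, every neck $N$ admits such a decomposition into oriented pieces, and $$Q(\overrightarrow{\mathrm{Vol}}\,N)\ \ge\ v_n^2,$$ with equality if and only if $N=W\cap H^+$ for some $n$-dimensional linear subspace $W\subset V$. -/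

import Mathlib

open MeasureTheory Set

noncomputable section

namespace Bottleneck

variable {V : Type*} [NormedAddCommGroup V] [NormedSpace ℝ V]

/-! ### The quadratic form on the exterior algebra -/

/-- The extension to `⋀^m V` of the bilinear form `⟨·,·⟩` associated to `Q`:
`⟨v₁ ∧ ⋯ ∧ vₘ, w₁ ∧ ⋯ ∧ wₘ⟩ = det ⟨vᵢ, wⱼ⟩`. -/
def extInner (Q : QuadraticForm ℝ V) (m : ℕ) : (⋀[ℝ]^m V) →ₗ[ℝ] (⋀[ℝ]^m V) →ₗ[ℝ] ℝ :=
  exteriorPower.pairingDual ℝ V m ∘ₗ exteriorPower.map m (QuadraticMap.associated (R := ℝ) Q)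

/-- The energy `Q(ω) = ⟨ω, ω⟩` of an `m`-tensor. -/
def energy (Q : QuadraticForm ℝ V) {m : ℕ} (ω : ⋀[ℝ]^m V) : ℝ := extInner Q m ω ω

theorem extInner_ιMulti (Q : QuadraticForm ℝ V) (m : ℕ) (v w : Fin m → V) :
    extInner Q m (exteriorPower.ιMulti ℝ m v) (exteriorPower.ιMulti ℝ m w) =
      Matrix.det (Matrix.of fun i j => QuadraticMap.associated (R := ℝ) Q (v i) (w j)) := by
  rw [← Matrix.det_transpose]
  simp [extInner, Matrix.transpose, Function.comp_def]

/-! ### Spacelike submanifolds of the hyperboloid and necks -/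

/-- The positive unit hyperboloid `H⁺`. -/
def hyperboloid (Q : QuadraticForm ℝ V) : Set V := {x | Q x = 1}

/-- The `j`-th partial derivative of `f` at `s`. -/
def partialDeriv {m : ℕ} (f : (Fin m → ℝ) → V) (s : Fin m → ℝ) (j : Fin m) : V :=
  fderiv ℝ f s (Pi.single j 1)

/-- `φ` restricted to the open set `U ⊆ ℝᵏ` is a local parametrization of `N`: a `C¹` immersion
which is a homeomorphism of `U` onto a relatively open subset of `N`. -/
structure IsLocalParam {k : ℕ} (N : Set V) (φ : (Fin k → ℝ) → V) (U : Set (Fin k → ℝ)) :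
    Prop where
  isOpen_dom : IsOpen U
  contDiffOn : ContDiffOn ℝ 1 φ U
  immersion : ∀ u ∈ U, Function.Injective (fderiv ℝ φ u)
  isEmbedding : Topology.IsEmbedding (U.domRestrict φ)
  isOpen_image : ∃ O : Set V, IsOpen O ∧ φ '' U = N ∩ O

/-- `N` is a closed (compact, without boundary) embedded `k`-dimensional `C¹` submanifold of `V`. -/
def IsClosedSubmanifold (k : ℕ) (N : Set V) : Prop :=
  IsCompact N ∧ ∀ x ∈ N, ∃ (φ : (Fin k → ℝ) → V) (U : Set (Fin k → ℝ)),
    IsLocalParam N φ U ∧ x ∈ φ '' U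

/-- All nonzero tangent vectors of the `k`-dimensional submanifold `N` are spacelike. -/
def IsSpacelike (Q : QuadraticForm ℝ V) (k : ℕ) (N : Set V) : Prop :=
  ∀ (φ : (Fin k → ℝ) → V) (U : Set (Fin k → ℝ)), IsLocalParam N φ U →
    ∀ u ∈ U, ∀ v : Fin k → ℝ, v ≠ 0 → 0 < Q (fderiv ℝ φ u v)

/-- A neck: a closed spacelike `k`-dimensional submanifold of `H⁺` whose inclusion into `H⁺` is a
homotopy equivalence. Here `Q` has signature `(k + 1, b)`. -/
structure IsNeck (Q : QuadraticForm ℝ V) (k : ℕ) (N : Set V) : Prop where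
  submanifold : IsClosedSubmanifold k N
  spacelike : IsSpacelike Q k N
  subset : N ⊆ hyperboloid Q
  homotopyEquiv : ∃ e : ContinuousMap.HomotopyEquiv N (hyperboloid Q),
    ∀ x : N, e x = Set.inclusion subset x

/-! ### Directed volume -/

/-- The directed volume `∫_S ∂₁f ∧ ⋯ ∧ ∂ₘf ds ∈ ⋀^m V` of the piece parametrized by `f` on
`S ⊆ ℝᵐ`. The integral of a function with values in the finite-dimensional space `⋀^m V` is taken
coordinatewise in a basis. -/
def directedVolume [FiniteDimensional ℝ V] {m : ℕ} (f : (Fin m → ℝ) → V) (S : Set (Fin m → ℝ)) : ⋀[ℝ]^m V :=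
  ∑ i, (∫ s in S, (Module.finBasis ℝ (⋀[ℝ]^m V)).repr
      (exteriorPower.ιMulti ℝ m (partialDeriv f s)) i) • Module.finBasis ℝ (⋀[ℝ]^m V) i

/-- The cone with apex the origin over a parametrized piece: `(t, u) ↦ t φ(u)`. -/
def coneMap {k : ℕ} (φ : (Fin k → ℝ) → V) (s : Fin (k + 1) → ℝ) : V := s 0 • φ (Fin.tail s)

/-- The parameter domain `(0, 1) × A` of the cone over the piece `φ '' A`. -/
def coneDomain {k : ℕ} (A : Set (Fin k → ℝ)) : Set (Fin (k + 1) → ℝ) :=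
  {s | s 0 ∈ Ioo (0 : ℝ) 1 ∧ Fin.tail s ∈ A}

/-- The simple tensor `φ(u) ∧ ∂₁φ(u) ∧ ⋯ ∧ ∂ₖφ(u)`, which spans the oriented `(k + 1)`-plane of the
cone over `N` at `φ(u)`. -/
def coneTensor {k : ℕ} (φ : (Fin k → ℝ) → V) (u : Fin k → ℝ) : ⋀[ℝ]^(k + 1) V :=
  exteriorPower.ιMulti ℝ (k + 1) (Fin.cons (φ u) (partialDeriv φ u))

/-- A decomposition of a neck `N` into finitely many disjoint oriented parametrized pieces.
The orientation of `N` is the one coming from a consistent orientation of all spacelike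
`(k + 1)`-planes of `V`; two oriented spacelike `(k + 1)`-planes, with oriented bases `v` and `w`,
are consistently oriented exactly if `det ⟨vᵢ, wⱼ⟩ > 0`. The number `sgn i = ±1` records whether
the `i`-th parametrization preserves or reverses the orientation. -/
structure OrientedDecomposition (Q : QuadraticForm ℝ V) (k : ℕ) (N : Set V) where
  size : ℕ
  chart : Fin size → (Fin k → ℝ) → V
  dom : Fin size → Set (Fin k → ℝ)
  isLocalParam : ∀ i, IsLocalParam N (chart i) (dom i)
  piece : Fin size → Set (Fin k → ℝ)
  measurableSet_piece : ∀ i, MeasurableSet (piece i)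
  isCompact_closure : ∀ i, IsCompact (closure (piece i))
  closure_subset : ∀ i, closure (piece i) ⊆ dom i
  disjoint : Pairwise fun i j => Disjoint (chart i '' piece i) (chart j '' piece j)
  cover : ⋃ i, chart i '' piece i = N
  sgn : Fin size → ℤˣ
  oriented : ∀ i j, ∀ u ∈ dom i, ∀ v ∈ dom j,
    0 < extInner Q (k + 1) (sgn i • coneTensor (chart i) u) (sgn j • coneTensor (chart j) v)

/-- The directed volume enclosed by `N`: the directed volume of the cone over `N` with apex the
origin, an oriented `(k + 1)`-chain with boundary `N`, oriented compatibly with `N`. -/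
def OrientedDecomposition.enclosedVolume [FiniteDimensional ℝ V] {Q : QuadraticForm ℝ V} {k : ℕ} {N : Set V}
    (D : OrientedDecomposition Q k N) : ⋀[ℝ]^(k + 1) V :=
  ∑ i, D.sgn i • directedVolume (coneMap (D.chart i)) (coneDomain (D.piece i))

/-- The volume `vₙ` of the unit ball in Euclidean space `ℝⁿ`. -/
def unitBallVolume (n : ℕ) : ℝ :=
  (volume (Metric.ball (0 : EuclideanSpace ℝ (Fin n)) 1)).toReal

end Bottleneck

end

noncomputable section

namespace Bottleneck

variable {V : Type*} [NormedAddCommGroup V] [NormedSpace ℝ V] {k : ℕ} {Q : QuadraticForm ℝ V}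

/-! ### Lorentzian linear algebra -/

/-! Put n = k + 1 and let ω be the volume enclosed by N. For a frame (ν, w), with ν unit timelike
and w an orthonormal basis of its orthogonal complement, the pairing of ω with w₀ ∧ ⋯ ∧ wₖ
integrates, piece by piece, the Jacobian of the cone over N followed by orthogonal projection to
span w (`det_proj_comp`). The tangent planes of the cone are spacelike and consistently oriented, so
by the reversed Cauchy-Schwarz inequality the signed Jacobian never changes sign (`exists_sign`).
Hence the absolute value of the pairing is at least the volume of the projected cone
(`volume_projCone_le`).

The projected cone contains the punctured unit ball. Every ray from the origin meets the projection
of N (`IsNeck.exists_smul_proj`), and a point x of N projects to a vector of squared length 1 + ⟨ν,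
x⟩², which is at least 1. So the pairing of ω with every frame is at least vₙ in absolute value.

The Hodge star turns this into a statement about one vector: Q(ω) = -Q(⋆ω), and the pairing with w
is ±⟨⋆ω, ν⟩. A vector whose product with every unit timelike vector is at least c in absolute value
satisfies -Q ≥ c² (`IsFrame.le_neg_apply`), which gives the inequality.

If equality holds, the normalized ⋆ω is a timelike direction whose projected cone has volume exactly
vₙ. A point of N off its orthogonal hyperplane would add an open set outside the ball, so N lies in
the hyperplane, and as it meets every ray there it is the whole section. Conversely, for a planar
neck the projection is injective on the cone and ⋆ω is parallel to ν, so no inequality is lost. -/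

/-- The symmetric bilinear form associated to `Q`. -/
abbrev bil (Q : QuadraticForm ℝ V) : V →ₗ[ℝ] V →ₗ[ℝ] ℝ := QuadraticMap.associated (R := ℝ) Q

theorem bil_comm (Q : QuadraticForm ℝ V) (x y : V) : bil Q x y = bil Q y x :=
  QuadraticMap.associated_isSymm ℝ Q x y

theorem bil_self (Q : QuadraticForm ℝ V) (x : V) : bil Q x x = Q x :=
  QuadraticMap.associated_eq_self_apply ℝ Q x

/-- An orthonormal frame of a Lorentzian space: a unit timelike vector `ν` and an orthonormal
spacelike family `w` orthogonal to it. -/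
structure IsFrame (Q : QuadraticForm ℝ V) (ν : V) (w : Fin (k + 1) → V) : Prop where
  timelike : bil Q ν ν = -1
  orth : ∀ j, bil Q ν (w j) = 0
  gram : ∀ i j, bil Q (w i) (w j) = if i = j then 1 else 0

theorem exists_orthonormal [FiniteDimensional ℝ V] {m : ℕ} (W : Submodule ℝ V)
    (hW : Module.finrank ℝ W = m) (hpos : ∀ x ∈ W, x ≠ 0 → 0 < Q x) :
    ∃ w : Fin m → V, (∀ i, w i ∈ W) ∧ ∀ i j, bil Q (w i) (w j) = if i = j then 1 else 0 := by
  subst hW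
  obtain ⟨v, hv⟩ := LinearMap.BilinForm.exists_orthogonal_basis
    (B := LinearMap.BilinForm.restrict (bil Q) W)
    ⟨fun x y => by simpa using bil_comm Q (x : V) y⟩
  have hvpos : ∀ i, 0 < Q (v i : V) := fun i =>
    hpos _ (v i).2 (by simpa using v.ne_zero i)
  refine ⟨fun i => (Real.sqrt (Q (v i : V)))⁻¹ • (v i : V), fun i => W.smul_mem _ (v i).2, ?_⟩
  intro i j
  have hs := Real.sq_sqrt (hvpos i).le
  have hs0 := Real.sqrt_pos.2 (hvpos i)
  split_ifs with h
  · subst h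
    rw [map_smul, map_smul, LinearMap.smul_apply, bil_self, smul_eq_mul, smul_eq_mul]
    field_simp
    exact hs.symm
  · have h0 : bil Q (v i : V) (v j : V) = 0 := hv h
    rw [map_smul, map_smul, LinearMap.smul_apply, h0]
    simp

theorem IsFrame.orth' {ν : V} {w : Fin (k + 1) → V} (h : IsFrame Q ν w) (j : Fin (k + 1)) :
    bil Q (w j) ν = 0 := by
  rw [bil_comm, h.orth]

theorem IsFrame.linearIndependent {ν : V} {w : Fin (k + 1) → V} (h : IsFrame Q ν w) :
    LinearIndependent ℝ (Fin.cons ν w : Fin (k + 1 + 1) → V) := by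
  rw [Fintype.linearIndependent_iff]
  intro c hc
  have key : ∀ x : V, bil Q x (∑ i, c i • (Fin.cons ν w : Fin (k + 1 + 1) → V) i) = 0 := by
    intro x; rw [hc, map_zero]
  intro i
  refine Fin.cases ?_ (fun j => ?_) i
  · have := key ν
    simpa [Fin.sum_univ_succ (n := k + 1), h.timelike, h.orth] using this
  · have := key (w j)
    simpa [Fin.sum_univ_succ (n := k + 1), h.orth', h.gram] using this

/-- The basis underlying a frame. -/
def IsFrame.basis {ν : V} {w : Fin (k + 1) → V} (h : IsFrame Q ν w)
    (hdim : Module.finrank ℝ V = (k + 1) + 1) : Module.Basis (Fin (k + 1 + 1)) ℝ V :=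
  basisOfLinearIndependentOfCardEqFinrank h.linearIndependent (by simp [hdim])

theorem IsFrame.coe_basis {ν : V} {w : Fin (k + 1) → V} (h : IsFrame Q ν w)
    (hdim : Module.finrank ℝ V = (k + 1) + 1) :
    (h.basis hdim : Fin (k + 1 + 1) → V) = Fin.cons ν w :=
  coe_basisOfLinearIndependentOfCardEqFinrank _ _

theorem IsFrame.expand {ν : V} {w : Fin (k + 1) → V} (h : IsFrame Q ν w)
    (hdim : Module.finrank ℝ V = (k + 1) + 1) (x : V) :
    x = -(bil Q ν x) • ν + ∑ j, bil Q (w j) x • w j := by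
  have hx : x = (h.basis hdim).repr x 0 • ν +
      ∑ j : Fin (k + 1), (h.basis hdim).repr x j.succ • w j := by
    conv_lhs => rw [← (h.basis hdim).sum_repr x]
    simp [Fin.sum_univ_succ (n := k + 1), h.coe_basis hdim]
  generalize (h.basis hdim).repr x = c at hx
  have h0 : bil Q ν x = - c 0 := by rw [hx]; simp [h.timelike, h.orth]
  have h1 : ∀ j, bil Q (w j) x = c j.succ := by intro j; rw [hx]; simp [h.orth', h.gram]
  simp only [h0, h1, neg_neg]
  exact hx

theorem IsFrame.bil_eq {ν : V} {w : Fin (k + 1) → V} (h : IsFrame Q ν w)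
    (hdim : Module.finrank ℝ V = (k + 1) + 1) (x y : V) :
    bil Q x y = -(bil Q ν x * bil Q ν y) + ∑ j, bil Q (w j) x * bil Q (w j) y := by
  conv_lhs => rw [h.expand hdim x]
  simp [LinearMap.sum_apply]

theorem IsFrame.apply_eq {ν : V} {w : Fin (k + 1) → V} (h : IsFrame Q ν w)
    (hdim : Module.finrank ℝ V = (k + 1) + 1) (x : V) :
    Q x = -(bil Q ν x) ^ 2 + ∑ j, (bil Q (w j) x) ^ 2 := by
  rw [← bil_self, h.bil_eq hdim]
  simp [sq]

theorem IsFrame.eq_zero {ν : V} {w : Fin (k + 1) → V} (h : IsFrame Q ν w)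
    (hdim : Module.finrank ℝ V = (k + 1) + 1) {x : V} (h0 : bil Q ν x = 0)
    (h1 : ∀ j, bil Q (w j) x = 0) : x = 0 := by
  rw [h.expand hdim x]; simp [h0, h1]

theorem bil_smul_sqrt_neg {a : V} (ha : Q a < 0) :
    bil Q ((Real.sqrt (-Q a))⁻¹ • a) ((Real.sqrt (-Q a))⁻¹ • a) = -1 := by
  have hs := Real.sq_sqrt (neg_pos.2 ha).le
  have hs0 := Real.sqrt_pos.2 (neg_pos.2 ha)
  rw [map_smul, map_smul, LinearMap.smul_apply, bil_self, smul_eq_mul, smul_eq_mul]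
  field_simp
  linarith

/-- A spacelike hyperplane extends to a frame. -/
theorem exists_frame_of_spacelike [FiniteDimensional ℝ V]
    (hdim : Module.finrank ℝ V = (k + 1) + 1) {t : V}
    (ht : Q t < 0) (W : Submodule ℝ V) (hW : Module.finrank ℝ W = k + 1)
    (hpos : ∀ x ∈ W, x ≠ 0 → 0 < Q x) :
    ∃ (ν : V) (w : Fin (k + 1) → V), IsFrame Q ν w ∧ ∀ x, x ∈ W ↔ bil Q ν x = 0 := by
  obtain ⟨w, hwW, hw⟩ := exists_orthonormal W hW hpos
  set a : V := t - ∑ j, bil Q (w j) t • w j with ha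
  have haw : ∀ j, bil Q (w j) a = 0 := by
    intro j; simp [ha, hw]
  have hta : bil Q t a = Q a := by
    have : t = a + ∑ j, bil Q (w j) t • w j := by rw [ha]; abel
    rw [← bil_self Q a]
    nth_rw 1 [this]
    simp [haw, LinearMap.sum_apply]
  have hQa : Q a = Q t - ∑ j, (bil Q (w j) t) ^ 2 := by
    rw [← hta, ha, map_sub, bil_self, map_sum]
    simp [sq, bil_comm Q t]
  -- Removing the spacelike component of `t` can only lower `Q`.
  have hneg : Q a < 0 := by
    have : 0 ≤ ∑ j, (bil Q (w j) t) ^ 2 := Finset.sum_nonneg fun _ _ => sq_nonneg _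
    linarith
  have hF : IsFrame Q ((Real.sqrt (-Q a))⁻¹ • a) w := by
    refine ⟨bil_smul_sqrt_neg hneg, fun j => ?_, hw⟩
    rw [map_smul, LinearMap.smul_apply, bil_comm, haw, smul_zero]
  have hspan : Submodule.span ℝ (range w) = W := by
    have hli : LinearIndependent ℝ w := by
      have := hF.linearIndependent.comp Fin.succ (Fin.succ_injective _)
      simpa [Function.comp_def] using this
    apply Submodule.eq_of_le_of_finrank_eq
    · rw [Submodule.span_le]; rintro _ ⟨j, rfl⟩; exact hwW j
    · rw [finrank_span_eq_card hli, hW]; simp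
  refine ⟨_, w, hF, fun x => ⟨fun hx => ?_, fun hx => ?_⟩⟩
  · rw [← hspan] at hx
    induction hx using Submodule.span_induction with
    | mem x hx => obtain ⟨j, rfl⟩ := hx; exact hF.orth j
    | zero => simp
    | add x y _ _ hx hy => rw [map_add, hx, hy, add_zero]
    | smul c x _ hx => rw [map_smul, hx, smul_zero]
  · rw [hF.expand hdim x, hx]
    simp only [neg_zero, zero_smul, zero_add]
    exact Submodule.sum_mem _ fun j _ => W.smul_mem _ (hwW j)

theorem finrank_ker_bil [FiniteDimensional ℝ V] (hdim : Module.finrank ℝ V = (k + 1) + 1) {a : V}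
    (ha : bil Q a a = -1) : Module.finrank ℝ (LinearMap.ker (bil Q a)) = k + 1 := by
  have h1 := (bil Q a).finrank_range_add_finrank_ker
  have h2 : LinearMap.range (bil Q a) = ⊤ := by
    rw [LinearMap.range_eq_top]
    intro c
    exact ⟨(-c) • a, by rw [map_smul, ha]; simp⟩
  rw [h2, finrank_top, Module.finrank_self, hdim] at h1
  omega

/-- Every unit timelike vector extends to a frame. -/
theorem IsFrame.exists_of_timelike [FiniteDimensional ℝ V] {ν : V} {w : Fin (k + 1) → V}
    (h : IsFrame Q ν w) (hdim : Module.finrank ℝ V = (k + 1) + 1) {a : V}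
    (ha : bil Q a a = -1) : ∃ u : Fin (k + 1) → V, IsFrame Q a u := by
  have ha' := ha
  rw [bil_self, h.apply_eq hdim] at ha'
  obtain ⟨u, hu, hgram⟩ := exists_orthonormal (Q := Q) (LinearMap.ker (bil Q a))
    (finrank_ker_bil hdim ha) (by
    intro x hx hx0
    rw [LinearMap.mem_ker, h.bil_eq hdim] at hx
    have hcs := Finset.sum_mul_sq_le_sq_mul_sq Finset.univ
      (fun j => bil Q (w j) a) (fun j => bil Q (w j) x)
    rw [h.apply_eq hdim]
    set A := ∑ j, (bil Q (w j) a) ^ 2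
    set X := ∑ j, (bil Q (w j) x) ^ 2 with hX
    have hA : 0 ≤ A := Finset.sum_nonneg fun _ _ => sq_nonneg _
    have hX0 : 0 ≤ X := Finset.sum_nonneg fun _ _ => sq_nonneg _
    have hS : ∑ j, bil Q (w j) a * bil Q (w j) x = bil Q ν a * bil Q ν x := by linarith
    rw [hS, mul_pow] at hcs
    -- If Q x ≤ 0, then (1 + A)τ² ≤ A X ≤ A τ² with τ = ⟨ν, x⟩, which forces τ = 0, then X = 0 and x
    -- = 0.
    by_contra hcon
    have h1 : X ≤ (bil Q ν x) ^ 2 := by linarith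
    have h2 : (bil Q ν a) ^ 2 = 1 + A := by linarith
    rw [h2] at hcs
    have h3 : (bil Q ν x) ^ 2 = 0 := by nlinarith [sq_nonneg (bil Q ν x)]
    have h4 : X = 0 := by linarith
    refine hx0 (h.eq_zero hdim (by simpa using h3) fun j => ?_)
    rw [hX, Finset.sum_eq_zero_iff_of_nonneg fun _ _ => sq_nonneg _] at h4
    simpa using h4 j (Finset.mem_univ j))
  exact ⟨u, ha, fun j => hu j, hgram⟩

/-- Reversed Cauchy-Schwarz: the time orientations of timelike vectors are consistent. -/
theorem IsFrame.timelike_trans [FiniteDimensional ℝ V] {ν : V} {w : Fin (k + 1) → V}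
    (h : IsFrame Q ν w) (hdim : Module.finrank ℝ V = (k + 1) + 1) {y a b : V}
    (hy : Q y < 0) (ha : Q a < 0) (hb : Q b < 0) :
    bil Q a b * (bil Q y a * bil Q y b) < 0 := by
  -- In a frame adapted to `y`, pairing with `y` reads off time coordinates up to a positive factor.
  -- For timelike vectors the product of time coordinates dominates the spacelike part.
  obtain ⟨u, hu⟩ := h.exists_of_timelike hdim (bil_smul_sqrt_neg hy)
  have hs0 := Real.sqrt_pos.2 (neg_pos.2 hy)
  set s := Real.sqrt (-Q y)
  set e := s⁻¹ • y with he
  have hye : y = s • e := by rw [he, smul_inv_smul₀ hs0.ne']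
  rw [hu.apply_eq hdim] at ha hb
  rw [hu.bil_eq hdim a b, hye]
  simp only [map_smul, LinearMap.smul_apply, smul_eq_mul]
  have hcs := Finset.sum_mul_sq_le_sq_mul_sq Finset.univ
      (fun j => bil Q (u j) a) (fun j => bil Q (u j) b)
  set A := ∑ j, (bil Q (u j) a) ^ 2
  set B := ∑ j, (bil Q (u j) b) ^ 2
  set S := ∑ j, bil Q (u j) a * bil Q (u j) b
  set α := bil Q e a
  set β := bil Q e b
  have hA : 0 ≤ A := Finset.sum_nonneg fun _ _ => sq_nonneg _
  have hB : 0 ≤ B := Finset.sum_nonneg fun _ _ => sq_nonneg _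
  have h1 : S ^ 2 < (α * β) ^ 2 := by
    rw [mul_pow]
    have : A * B < α ^ 2 * β ^ 2 := mul_lt_mul'' (by linarith) (by linarith) hA hB
    linarith
  have h2 : |S| < |α * β| := sq_lt_sq.1 h1
  have h3 : S * (α * β) < (α * β) ^ 2 := by
    calc S * (α * β) ≤ |S| * |α * β| := by rw [← abs_mul]; exact le_abs_self _
      _ < |α * β| * |α * β| := mul_lt_mul_of_pos_right h2 (lt_of_le_of_lt (abs_nonneg _) h2)
      _ = (α * β) ^ 2 := by rw [abs_mul_abs_self, sq]
  have : (-(α * β) + S) * (s * α * (s * β)) = s ^ 2 * (S * (α * β) - (α * β) ^ 2) := by ring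
  rw [this]
  exact mul_neg_of_pos_of_neg (by positivity) (by linarith)

theorem exists_frame [FiniteDimensional ℝ V] (hdim : Module.finrank ℝ V = (k + 1) + 1)
    (hpos : sigPos Q = k + 1) (hneg : sigNeg Q = 1) :
    ∃ (ν : V) (w : Fin (k + 1) → V), IsFrame Q ν w := by
  obtain ⟨W, hW, hWpos⟩ := exists_finrank_eq_sigPos_and_posDef Q
  obtain ⟨N, hN, hNneg⟩ := exists_finrank_eq_sigNeg_and_negDef Q
  rw [hneg] at hN
  obtain ⟨t, ht0, -⟩ := finrank_eq_one_iff'.1 hN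
  have ht : Q (t : V) < 0 := by simpa using hNneg t ht0
  obtain ⟨ν, w, hF, -⟩ := exists_frame_of_spacelike hdim ht W (hW.trans hpos) fun x hx hx0 => by
    simpa using hWpos ⟨x, hx⟩ (by simpa using hx0)
  exact ⟨ν, w, hF⟩

/-! ### The Hodge star -/

/-- The pairing `(v, ω) ↦ det (v ∧ ω)` relative to a basis. -/
def wedgeDet {m : ℕ} (B : Module.Basis (Fin (m + 1)) ℝ V) : V →ₗ[ℝ] (⋀[ℝ]^m V) →ₗ[ℝ] ℝ :=
  (exteriorPower.alternatingMapLinearEquiv (R := ℝ)).toLinearMap ∘ₗ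
    AlternatingMap.curryLeft (n := m) B.det

theorem wedgeDet_ιMulti {m : ℕ} (B : Module.Basis (Fin (m + 1)) ℝ V) (v : V) (u : Fin m → V) :
    wedgeDet B v (exteriorPower.ιMulti ℝ m u) = B.det (Fin.cons v u) := by
  simp only [wedgeDet, LinearMap.comp_apply, LinearEquiv.coe_coe,
    exteriorPower.alternatingMapLinearEquiv_apply_ιMulti]
  rfl

/-- The Hodge star relative to a frame: `⟨⋆ω, v⟩ = det (v ∧ ω)`. -/
def IsFrame.star {ν : V} {w : Fin (k + 1) → V} (h : IsFrame Q ν w)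
    (hdim : Module.finrank ℝ V = (k + 1) + 1) : (⋀[ℝ]^(k + 1) V) →ₗ[ℝ] V :=
  -(wedgeDet (h.basis hdim) ν).smulRight ν +
    ∑ j, (wedgeDet (h.basis hdim) (w j)).smulRight (w j)

section

variable {ν : V} {w : Fin (k + 1) → V} (h : IsFrame Q ν w)
  (hdim : Module.finrank ℝ V = (k + 1) + 1)

theorem IsFrame.bil_star (ω : ⋀[ℝ]^(k + 1) V) (v : V) :
    bil Q (h.star hdim ω) v = wedgeDet (h.basis hdim) v ω := by
  conv_rhs => rw [h.expand hdim v]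
  simp [IsFrame.star, LinearMap.sum_apply, mul_comm]

theorem IsFrame.repr_basis (x : V) :
    ((h.basis hdim).repr x : Fin (k + 1 + 1) → ℝ) =
      Fin.cons (-(bil Q ν x)) fun j => bil Q (w j) x := by
  have hx : x = (h.basis hdim).repr x 0 • ν +
      ∑ j : Fin (k + 1), (h.basis hdim).repr x j.succ • w j := by
    conv_lhs => rw [← (h.basis hdim).sum_repr x]
    simp [Fin.sum_univ_succ (n := k + 1), h.coe_basis hdim]
  generalize (h.basis hdim).repr x = c at hx
  funext i
  refine Fin.cases ?_ (fun j => ?_) i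
  · rw [hx]; simp [h.timelike, h.orth]
  · rw [hx]; simp [h.orth', h.gram]

/-- The Gram matrix factors as Aᵀ diag(-1, 1, …, 1) B through coordinates in the frame; the minus
sign is the determinant of the diagonal factor. -/
theorem IsFrame.det_gram (a b : Fin (k + 1 + 1) → V) :
    Matrix.det (Matrix.of fun i j => bil Q (a i) (b j)) =
      -((h.basis hdim).det a * (h.basis hdim).det b) := by
  have hM : (Matrix.of fun i j => bil Q (a i) (b j)) =
      ((h.basis hdim).toMatrix a).transpose *
        (Matrix.diagonal (Fin.cons (-1) fun _ => 1 : Fin (k + 1 + 1) → ℝ)) *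
        (h.basis hdim).toMatrix b := by
    ext i j
    rw [Matrix.mul_assoc, Matrix.mul_apply, Fin.sum_univ_succ]
    simp only [Matrix.diagonal_mul, Matrix.transpose_apply, Module.Basis.toMatrix_apply,
      Matrix.of_apply]
    rw [h.repr_basis hdim, h.repr_basis hdim, h.bil_eq hdim]
    simp
  rw [hM, Matrix.det_mul, Matrix.det_mul, Matrix.det_transpose, Matrix.det_diagonal,
    Fin.prod_univ_succ, Module.Basis.det_apply, Module.Basis.det_apply]
  simp

/-- By bilinearity simple tensors suffice. With s, s' the stars of v, v' and y completing v' to a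
basis, compare two values of the Gram determinant of (s', v) against (y, v'). Its first row is (⟨s',
y⟩, 0, …, 0), because s' is orthogonal to each v'ⱼ, while `det_gram` evaluates it as -⟨s, s'⟩⟨s',
y⟩. Cancel ⟨s', y⟩ ≠ 0. -/
theorem IsFrame.extInner_eq (ω ω' : ⋀[ℝ]^(k + 1) V) :
    extInner Q (k + 1) ω ω' = -bil Q (h.star hdim ω) (h.star hdim ω') := by
  have key : ∀ v v' : Fin (k + 1) → V,
      extInner Q (k + 1) (exteriorPower.ιMulti ℝ _ v) (exteriorPower.ιMulti ℝ _ v') =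
        -bil Q (h.star hdim (exteriorPower.ιMulti ℝ _ v))
          (h.star hdim (exteriorPower.ιMulti ℝ _ v')) := by
    intro v v'
    rw [extInner_ιMulti]
    by_cases hv' : LinearIndependent ℝ v'
    · obtain ⟨y, hy⟩ := exists_linearIndependent_cons_of_lt_finrank hv' (by omega)
      set s := h.star hdim (exteriorPower.ιMulti ℝ _ v) with hs
      set s' := h.star hdim (exteriorPower.ιMulti ℝ _ v') with hs'
      have hne : bil Q s' y ≠ 0 := by
        rw [hs', h.bil_star, wedgeDet_ιMulti]
        have := (((h.basis hdim).is_basis_iff_det (v := (Fin.cons y v' : Fin (k + 1 + 1) → V))).1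
          ⟨hy, hy.span_eq_top_of_card_eq_finrank (by simp [hdim])⟩)
        exact this.ne_zero
      have h0 : ∀ j, bil Q s' (v' j) = 0 := by
        intro j
        rw [hs', h.bil_star, wedgeDet_ιMulti]
        exact AlternatingMap.map_eq_zero_of_eq _ _ (i := 0) (j := j.succ) (by simp)
          (Fin.succ_ne_zero j).symm
      have h1 := h.det_gram hdim (Fin.cons s' v) (Fin.cons y v')
      rw [← wedgeDet_ιMulti, ← wedgeDet_ιMulti, ← h.bil_star, ← h.bil_star, ← hs, ← hs',
        Matrix.det_succ_row_zero, Fin.sum_univ_succ] at h1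
      have h2 : (Matrix.of fun i j : Fin (k + 1 + 1) =>
          bil Q ((Fin.cons s' v : Fin (k + 1 + 1) → V) i)
            ((Fin.cons y v' : Fin (k + 1 + 1) → V) j)).submatrix Fin.succ (Fin.succAbove 0) =
          Matrix.of fun i j => bil Q (v i) (v' j) := by
        ext i j; simp
      rw [h2] at h1
      simp only [Matrix.of_apply, Fin.cons_zero, Fin.cons_succ, h0, mul_zero, zero_mul,
        Finset.sum_const_zero, add_zero, Fin.val_zero, pow_zero, one_mul] at h1
      have : bil Q s' y *
          (Matrix.det (Matrix.of fun i j => bil Q (v i) (v' j)) + bil Q s s') = 0 := by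
        rw [mul_add, h1]; ring
      have := (mul_eq_zero.1 this).resolve_left hne
      linarith
    · rw [← extInner_ιMulti, AlternatingMap.map_linearDependent _ v' hv']
      simp
  have : extInner Q (k + 1) = -((bil Q).compl₁₂ (h.star hdim) (h.star hdim)) := by
    apply exteriorPower.linearMap_ext
    ext v : 1
    apply exteriorPower.linearMap_ext
    ext v' : 1
    simpa using key v v'
  rw [this]; simp

theorem IsFrame.energy_eq (ω : ⋀[ℝ]^(k + 1) V) : energy Q ω = -Q (h.star hdim ω) := by
  rw [energy, h.extInner_eq hdim, bil_self]

/-- The star is orthogonal to every `u j`, hence a multiple of `a`; comparing energies leaves only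
the factors ±1. -/
theorem IsFrame.star_frame {a : V} {u : Fin (k + 1) → V} (hu : IsFrame Q a u) :
    ∃ δ : ℝ, δ ^ 2 = 1 ∧ h.star hdim (exteriorPower.ιMulti ℝ _ u) = δ • a := by
  set s := h.star hdim (exteriorPower.ιMulti ℝ _ u) with hs
  have h0 : ∀ j, bil Q (u j) s = 0 := by
    intro j
    rw [bil_comm, hs, h.bil_star, wedgeDet_ιMulti]
    exact AlternatingMap.map_eq_zero_of_eq _ _ (i := 0) (j := j.succ) (by simp)
      (Fin.succ_ne_zero j).symm
  have hsa : s = (-(bil Q a s)) • a := by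
    conv_lhs => rw [hu.expand hdim s]
    simp [h0]
  refine ⟨_, ?_, hsa⟩
  have h1 := h.extInner_eq hdim (exteriorPower.ιMulti ℝ _ u) (exteriorPower.ιMulti ℝ _ u)
  have h2 : (Matrix.of fun i j => bil Q (u i) (u j)) = 1 := by
    ext i j; simp [hu.gram, Matrix.one_apply]
  rw [extInner_ιMulti, h2, Matrix.det_one, ← hs] at h1
  rw [hsa] at h1
  simp only [map_smul, LinearMap.smul_apply, hu.timelike, smul_eq_mul] at h1
  nlinarith

/-- The pairing with the volume form of a frame is the time coordinate of the Hodge star. -/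
theorem IsFrame.extInner_frame_sq {a : V} {u : Fin (k + 1) → V} (hu : IsFrame Q a u)
    (ω : ⋀[ℝ]^(k + 1) V) :
    extInner Q (k + 1) ω (exteriorPower.ιMulti ℝ _ u) ^ 2 = bil Q (h.star hdim ω) a ^ 2 := by
  obtain ⟨δ, hδ, hs⟩ := h.star_frame hdim hu
  rw [h.extInner_eq hdim, hs, map_smul, smul_eq_mul, neg_sq, mul_pow, hδ, one_mul]

/-- Test the hypothesis on the line ν + r p, where p is the spacelike part of y. The resulting
quadratic in r is nonnegative, and its discriminant is 4 S c² (c² + Q y) with S = Q p. The case S =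
0 needs only r = 0. -/
theorem IsFrame.discriminant_le (h : IsFrame Q ν w) {y : V} {c : ℝ}
    (hall : ∀ a : V, 0 ≤ bil Q y a ^ 2 + c ^ 2 * Q a) (hc : 0 < c)
    (hdim : Module.finrank ℝ V = (k + 1) + 1) :
    c ^ 2 ≤ -Q y := by
  have hQ : ∀ x : V, Q x = -(bil Q ν x) ^ 2 + ∑ j, (bil Q (w j) x) ^ 2 := h.apply_eq hdim
  set S := ∑ j, (bil Q (w j) y) ^ 2 with hS
  set τ := bil Q ν y with hτ
  have hS0 : 0 ≤ S := Finset.sum_nonneg fun _ _ => sq_nonneg _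
  have hQy : Q y = -τ ^ 2 + S := hQ y
  have hν := hall ν
  rw [← bil_self Q ν, h.timelike, bil_comm, ← hτ] at hν
  set p : V := ∑ j, bil Q (w j) y • w j with hp
  have hyp : bil Q y p = S := by
    simp [hp, hS, sq, bil_comm Q y]
  have hνp : bil Q ν p = 0 := by simp [hp, h.orth]
  have hwp : ∀ j, bil Q (w j) p = bil Q (w j) y := by intro j; simp [hp, h.gram]
  have hpp : bil Q p p = S := by
    rw [bil_self, hQ, hνp]; simp [hwp, hS]
  have hquad : ∀ r : ℝ, 0 ≤ (S ^ 2 + c ^ 2 * S) * (r * r) + (2 * τ * S) * r +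
      (τ ^ 2 - c ^ 2) := by
    intro r
    have := hall (ν + r • p)
    have e1 : bil Q y (ν + r • p) = τ + r * S := by
      rw [map_add, map_smul, hyp, bil_comm, smul_eq_mul]
    have e2 : Q (ν + r • p) = -1 + r ^ 2 * S := by
      rw [← bil_self]
      simp only [map_add, map_smul, LinearMap.add_apply, LinearMap.smul_apply, h.timelike, hνp,
        bil_comm Q p ν, hpp, smul_eq_mul]
      ring
    rw [e1, e2] at this
    linarith
  have hd := discrim_le_zero hquad
  rw [discrim] at hd
  rw [hQy]
  clear_value S τ
  rcases hS0.eq_or_lt with h0 | h0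
  · rw [← h0]; linarith
  · have h1 : 4 * S * c ^ 2 * (c ^ 2 - (τ ^ 2 - S)) ≤ 0 := by
      calc _ = (2 * τ * S) ^ 2 - 4 * (S ^ 2 + c ^ 2 * S) * (τ ^ 2 - c ^ 2) := by ring
        _ ≤ 0 := hd
    have h4 : 0 < 4 * S * c ^ 2 := by positivity
    have := nonpos_of_mul_nonpos_right h1 h4
    linarith

/-- A vector whose pairing with every unit timelike vector is at least `c` is timelike of norm at
least `c`. -/
theorem IsFrame.le_neg_apply (h : IsFrame Q ν w)
    (hdim : Module.finrank ℝ V = (k + 1) + 1) {y : V} {c : ℝ} (hc : 0 < c)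
    (hunit : ∀ a : V, bil Q a a = -1 → c ^ 2 ≤ bil Q y a ^ 2) : c ^ 2 ≤ -Q y := by
  refine h.discriminant_le (fun a => ?_) hc hdim
  rcases le_or_gt 0 (Q a) with ha | ha
  · positivity
  · have h1 := hunit _ (bil_smul_sqrt_neg ha)
    have hs := Real.sq_sqrt (neg_pos.2 ha).le
    rw [map_smul, smul_eq_mul, mul_pow, inv_pow, hs] at h1
    have h2 := mul_le_mul_of_nonneg_left h1 (neg_pos.2 ha).le
    rw [mul_inv_cancel_left₀ (neg_pos.2 ha).ne'] at h2
    linarith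

/-- If the pairing of `ω` with every unit timelike simple tensor is at least `c` then
`Q(ω) ≥ c²`, and in the case of equality some pairing is equal to `c`. -/
theorem IsFrame.le_energy [FiniteDimensional ℝ V] (h : IsFrame Q ν w)
    (hdim : Module.finrank ℝ V = (k + 1) + 1) (ω : ⋀[ℝ]^(k + 1) V) {c : ℝ} (hc : 0 < c)
    (hω : ∀ (a : V) (u : Fin (k + 1) → V), IsFrame Q a u →
      c ≤ |extInner Q (k + 1) ω (exteriorPower.ιMulti ℝ _ u)|) :
    c ^ 2 ≤ energy Q ω ∧ (energy Q ω = c ^ 2 → ∃ (a : V) (u : Fin (k + 1) → V), IsFrame Q a u ∧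
      |extInner Q (k + 1) ω (exteriorPower.ιMulti ℝ _ u)| = c) := by
  rw [h.energy_eq hdim]
  have hle : c ^ 2 ≤ -Q (h.star hdim ω) := by
    refine h.le_neg_apply hdim hc fun a ha => ?_
    obtain ⟨u, hu⟩ := h.exists_of_timelike hdim ha
    rw [← h.extInner_frame_sq hdim hu, ← sq_abs (extInner Q (k + 1) ω _)]
    exact pow_le_pow_left₀ hc.le (hω a u hu) 2
  refine ⟨hle, fun heq => ?_⟩
  -- The extremal timelike direction is ⋆ω itself, rescaled by 1/c.
  have hs : Real.sqrt (-Q (h.star hdim ω)) = c := by rw [heq, Real.sqrt_sq hc.le]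
  have hc2 := pow_pos hc 2
  have ha := bil_smul_sqrt_neg (Q := Q) (a := h.star hdim ω) (by linarith)
  obtain ⟨u, hu⟩ := h.exists_of_timelike hdim ha
  refine ⟨_, u, hu, ?_⟩
  have h1 := h.extInner_frame_sq hdim hu ω
  have h2 : Q (h.star hdim ω) = -c ^ 2 := by linarith
  rw [map_smul, bil_self, h2, smul_eq_mul, mul_pow, inv_pow, neg_neg, Real.sq_sqrt hc2.le] at h1
  have h3 : (c ^ 2)⁻¹ * (-c ^ 2) ^ 2 = c ^ 2 := by field_simp
  rw [h3, sq_eq_sq_iff_abs_eq_abs, abs_of_pos hc] at h1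
  exact h1

/-- If `u` spans the support of `ω` then `Q(ω)` is the square of the pairing of `ω` with `u`. -/
theorem IsFrame.energy_eq_sq {ω : ⋀[ℝ]^(k + 1) V} (hω : ∀ j, wedgeDet (h.basis hdim) (w j) ω = 0) :
    energy Q ω = extInner Q (k + 1) ω (exteriorPower.ιMulti ℝ _ w) ^ 2 := by
  rw [h.extInner_frame_sq hdim h, h.energy_eq hdim, h.apply_eq hdim]
  simp [bil_comm Q (w _), h.bil_star, hω, bil_comm Q ν]

/-- The energy of a simple tensor is its Gram determinant, here of a positive definite matrix. -/
theorem energy_ιMulti_pos {m : ℕ} (v : Fin m → V)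
    (hv : ∀ c : Fin m → ℝ, c ≠ 0 → 0 < Q (∑ i, c i • v i)) :
    0 < energy Q (exteriorPower.ιMulti ℝ m v) := by
  rw [energy, extInner_ιMulti]
  refine Matrix.PosDef.det_pos (Matrix.PosDef.of_dotProduct_mulVec_pos ?_ fun c hc => ?_)
  · ext i j; simp [bil_comm Q (v i)]
  · have := hv c hc
    rw [← bil_self] at this
    simpa [dotProduct, Matrix.mulVec, LinearMap.sum_apply, Finset.mul_sum, mul_comm,
      mul_left_comm, bil_comm Q] using this

/-- The pairings of spacelike simple tensors have consistent signs. -/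
theorem IsFrame.extInner_trans [FiniteDimensional ℝ V] (h : IsFrame Q ν w)
    (hdim : Module.finrank ℝ V = (k + 1) + 1) {ω a b : ⋀[ℝ]^(k + 1) V}
    (hω : 0 < energy Q ω) (ha : 0 < energy Q a) (hb : 0 < energy Q b) :
    0 < extInner Q (k + 1) a b * (extInner Q (k + 1) a ω * extInner Q (k + 1) b ω) := by
  simp only [h.energy_eq hdim, h.extInner_eq hdim] at *
  have := h.timelike_trans hdim (neg_pos.1 hω) (neg_pos.1 ha) (neg_pos.1 hb)
  rw [bil_comm Q _ (h.star hdim ω), bil_comm Q _ (h.star hdim ω)]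
  linarith

theorem IsFrame.energy_frame (h : IsFrame Q ν w) :
    energy Q (exteriorPower.ιMulti ℝ _ w) = 1 := by
  have h2 : (Matrix.of fun i j => bil Q (w i) (w j)) = 1 := by
    ext i j; simp [h.gram, Matrix.one_apply]
  rw [energy, extInner_ιMulti, h2, Matrix.det_one]

end

/-! ### Cones over local parametrizations -/

section LocalParam

variable {N : Set V} {φ : (Fin k → ℝ) → V} {U : Set (Fin k → ℝ)}

theorem IsLocalParam.contDiffAt (hφ : IsLocalParam N φ U) {u : Fin k → ℝ} (hu : u ∈ U) :
    ContDiffAt ℝ 1 φ u :=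
  hφ.contDiffOn.contDiffAt (hφ.isOpen_dom.mem_nhds hu)

theorem IsLocalParam.hasFDerivAt (hφ : IsLocalParam N φ U) {u : Fin k → ℝ} (hu : u ∈ U) :
    HasFDerivAt φ (fderiv ℝ φ u) u :=
  ((hφ.contDiffAt hu).differentiableAt one_ne_zero).hasFDerivAt

theorem IsLocalParam.mem (hφ : IsLocalParam N φ U) {u : Fin k → ℝ} (hu : u ∈ U) : φ u ∈ N := by
  obtain ⟨O, -, hO⟩ := hφ.isOpen_image
  exact (hO ▸ mem_image_of_mem φ hu : φ u ∈ N ∩ O).1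

theorem IsLocalParam.injOn (hφ : IsLocalParam N φ U) : InjOn φ U := by
  intro a ha b hb hab
  exact congrArg Subtype.val (hφ.isEmbedding.injective (a₁ := ⟨a, ha⟩) (a₂ := ⟨b, hb⟩) hab)

theorem fderiv_eq_sum_partialDeriv {m : ℕ} (f : (Fin m → ℝ) → V) (s v : Fin m → ℝ) :
    fderiv ℝ f s v = ∑ j, v j • partialDeriv f s j := by
  conv_lhs => rw [pi_eq_sum_univ' v]
  simp only [map_sum, map_smul, partialDeriv]
/-- Position vectors are orthogonal to tangent vectors. -/
theorem IsLocalParam.bil_fderiv [FiniteDimensional ℝ V] (hφ : IsLocalParam N φ U)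
    (hN : N ⊆ hyperboloid Q) {u : Fin k → ℝ} (hu : u ∈ U) (v : Fin k → ℝ) :
    bil Q (φ u) (fderiv ℝ φ u v) = 0 := by
  have hd := hφ.hasFDerivAt hu
  have h1 := (bil Q).toContinuousBilinearMap.hasFDerivAt_of_bilinear hd hd
  have h2 : HasFDerivAt (fun u => bil Q (φ u) (φ u)) (0 : (Fin k → ℝ) →L[ℝ] ℝ) u := by
    refine (hasFDerivAt_const (1 : ℝ) u).congr_of_eventuallyEq ?_
    filter_upwards [hφ.isOpen_dom.mem_nhds hu] with x hx
    rw [bil_self]; exact hN (hφ.mem hx)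
  have h3 : bil Q (φ u) (fderiv ℝ φ u v) + bil Q (fderiv ℝ φ u v) (φ u) = 0 :=
    congrArg (fun L => L v) (h1.unique h2)
  rw [bil_comm Q (fderiv ℝ φ u v)] at h3
  linarith

/-- The tangent plane of the cone is spacelike. -/
theorem IsLocalParam.spacelike_cone [FiniteDimensional ℝ V] (hφ : IsLocalParam N φ U)
    (hN : N ⊆ hyperboloid Q) (hs : IsSpacelike Q k N) {u : Fin k → ℝ} (hu : u ∈ U)
    {c : ℝ} {v : Fin k → ℝ} (hcv : c ≠ 0 ∨ v ≠ 0) : 0 < Q (c • φ u + fderiv ℝ φ u v) := by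
  have h0 := hφ.bil_fderiv hN hu v
  have h1 : Q (φ u) = 1 := hN (hφ.mem hu)
  have h2 : Q (c • φ u + fderiv ℝ φ u v) = c ^ 2 + Q (fderiv ℝ φ u v) := by
    rw [← bil_self]
    simp only [map_add, map_smul, LinearMap.add_apply, LinearMap.smul_apply, h0,
      bil_comm Q (fderiv ℝ φ u v) (φ u), bil_self, h1, smul_eq_mul]
    ring
  rw [h2]
  by_cases hv : v = 0
  · have hc : c ≠ 0 := hcv.resolve_right (by simpa using hv)
    subst hv
    simp only [map_zero, add_zero]
    positivity
  · have := hs φ U hφ u hu v hv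
    positivity

theorem IsLocalParam.energy_coneTensor_pos [FiniteDimensional ℝ V] (hφ : IsLocalParam N φ U)
    (hN : N ⊆ hyperboloid Q) (hs : IsSpacelike Q k N) {u : Fin k → ℝ} (hu : u ∈ U) :
    0 < energy Q (coneTensor φ u) := by
  refine energy_ιMulti_pos _ fun c hc => ?_
  have : ∑ i, c i • (Fin.cons (φ u) (partialDeriv φ u) : Fin (k + 1) → V) i =
      c 0 • φ u + fderiv ℝ φ u (Fin.tail c) := by
    rw [Fin.sum_univ_succ, fderiv_eq_sum_partialDeriv]
    simp [Fin.tail]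
  rw [this]
  refine hφ.spacelike_cone hN hs hu ?_
  by_contra hcon
  push Not at hcon
  apply hc
  rw [← Fin.cons_self_tail c, hcon.1, hcon.2]
  ext i
  refine Fin.cases ?_ (fun j => ?_) i <;> simp

/-- `Fin.tail` as a continuous linear map. -/
def tailL (k : ℕ) : (Fin (k + 1) → ℝ) →L[ℝ] (Fin k → ℝ) :=
  ContinuousLinearMap.pi fun j => ContinuousLinearMap.proj j.succ

theorem tailL_apply (s : Fin (k + 1) → ℝ) : tailL k s = Fin.tail s := rfl

theorem IsLocalParam.contDiffAt_coneMap (hφ : IsLocalParam N φ U) {s : Fin (k + 1) → ℝ}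
    (hs : Fin.tail s ∈ U) : ContDiffAt ℝ 1 (coneMap φ) s := by
  have h1 : ContDiffAt ℝ 1 (fun s => φ (tailL k s)) s :=
    (hφ.contDiffAt hs).comp s (tailL k).contDiff.contDiffAt
  have h2 : ContDiffAt ℝ 1 (fun s : Fin (k + 1) → ℝ => s 0) s :=
    (ContinuousLinearMap.proj (R := ℝ) (φ := fun _ : Fin (k + 1) => ℝ) 0).contDiff.contDiffAt
  exact h2.smul h1

theorem IsLocalParam.fderiv_coneMap (hφ : IsLocalParam N φ U) {s : Fin (k + 1) → ℝ}
    (hs : Fin.tail s ∈ U) (v : Fin (k + 1) → ℝ) :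
    fderiv ℝ (coneMap φ) s v =
      s 0 • fderiv ℝ φ (Fin.tail s) (Fin.tail v) + v 0 • φ (Fin.tail s) := by
  have h1 : HasFDerivAt (fun s => φ (tailL k s)) _ s :=
    (hφ.hasFDerivAt hs).comp s (tailL k).hasFDerivAt
  have h2 : HasFDerivAt (fun s : Fin (k + 1) → ℝ => s 0) _ s :=
    (ContinuousLinearMap.proj (R := ℝ) (φ := fun _ : Fin (k + 1) => ℝ) 0).hasFDerivAt
  have h3 : HasFDerivAt (coneMap φ) _ s := h2.smul h1
  rw [h3.fderiv]
  simp [tailL_apply]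

theorem IsLocalParam.partialDeriv_coneMap (hφ : IsLocalParam N φ U) {s : Fin (k + 1) → ℝ}
    (hs : Fin.tail s ∈ U) :
    partialDeriv (coneMap φ) s =
      Fin.cons (φ (Fin.tail s)) fun j => s 0 • partialDeriv φ (Fin.tail s) j := by
  funext i
  rw [partialDeriv, hφ.fderiv_coneMap hs]
  refine Fin.cases ?_ (fun j => ?_) i
  · have : Fin.tail (Pi.single 0 1 : Fin (k + 1) → ℝ) = 0 := by
      ext j; simp [Fin.tail]
    simp [this]
  · have : Fin.tail (Pi.single j.succ 1 : Fin (k + 1) → ℝ) = Pi.single j 1 := by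
      ext i; simp [Fin.tail, Pi.single_apply]
    simp [this, partialDeriv]

/-- All columns but the radial one carry the factor `s 0`. Since it is positive on the cone domain,
signs need only be controlled on N. -/
theorem IsLocalParam.ιMulti_coneMap (hφ : IsLocalParam N φ U) {s : Fin (k + 1) → ℝ}
    (hs : Fin.tail s ∈ U) :
    exteriorPower.ιMulti ℝ (k + 1) (partialDeriv (coneMap φ) s) =
      s 0 ^ k • coneTensor φ (Fin.tail s) := by
  rw [hφ.partialDeriv_coneMap hs, coneTensor]
  have := (exteriorPower.ιMulti ℝ (k + 1)).map_smul_univ (Fin.cons 1 fun _ => s 0)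
    (Fin.cons (φ (Fin.tail s)) (partialDeriv φ (Fin.tail s)) : Fin (k + 1) → V)
  rw [Fin.prod_univ_succ] at this
  simp only [Fin.cons_zero, Fin.cons_succ, Finset.prod_const, one_mul, Finset.card_univ,
    Fintype.card_fin] at this
  rw [← this]
  congr 1
  funext i
  refine Fin.cases ?_ (fun j => ?_) i <;> simp

end LocalParam

/-! ### Directed volumes -/

/-- Multilinear expansion in a basis makes `f` a polynomial in the coordinates. -/
theorem continuous_alternatingMap [FiniteDimensional ℝ V] {m : ℕ} (f : V [⋀^Fin m]→ₗ[ℝ] ℝ) :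
    Continuous fun v : Fin m → V => f v := by
  classical
  set b := Module.finBasis ℝ V
  have : (fun v : Fin m → V => f v) = fun v => ∑ r : Fin m → Fin (Module.finrank ℝ V),
      (∏ i, b.repr (v i) (r i)) * f (fun i => b (r i)) := by
    funext v
    conv_lhs => rw [show v = fun i => ∑ j, b.repr (v i) j • b j from
      funext fun i => (b.sum_repr (v i)).symm]
    have := f.toMultilinearMap.map_sum (fun i j => b.repr (v i) j • b j)
    simp only [AlternatingMap.coe_multilinearMap] at this
    rw [this]
    refine Finset.sum_congr rfl fun r _ => ?_
    rw [f.map_smul_univ (fun i => b.repr (v i) (r i)), smul_eq_mul]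
  rw [this]
  have hc : ∀ j, Continuous fun x : V => b.repr x j := fun j =>
    (b.coord j).continuous_of_finiteDimensional
  refine continuous_finsetSum _ fun r _ => Continuous.mul (continuous_finsetProd _ fun i _ => ?_)
    continuous_const
  exact (hc _).comp (continuous_apply i)

theorem continuousOn_partialDeriv {m : ℕ} {f : (Fin m → ℝ) → V} {O : Set (Fin m → ℝ)}
    (hO : IsOpen O) (hf : ContDiffOn ℝ 1 f O) : ContinuousOn (partialDeriv f) O :=
  continuousOn_pi.2 fun _ => (hf.continuousOn_fderiv_of_isOpen hO le_rfl).clm_apply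
    continuousOn_const

theorem integrableOn_alternatingMap [FiniteDimensional ℝ V] {m : ℕ} {f : (Fin m → ℝ) → V}
    {O K S : Set (Fin m → ℝ)} (hO : IsOpen O) (hf : ContDiffOn ℝ 1 f O) (hK : IsCompact K)
    (hKO : K ⊆ O) (hSK : S ⊆ K) (g : V [⋀^Fin m]→ₗ[ℝ] ℝ) :
    IntegrableOn (fun s => g (partialDeriv f s)) S :=
  (((continuous_alternatingMap g).comp_continuousOn
    ((continuousOn_partialDeriv hO hf).mono hKO)).integrableOn_compact hK).mono_set hSK

/-- This frees the coordinatewise definition from its basis. The compact set K supplies the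
integrability needed to exchange sum and integral. -/
theorem apply_directedVolume [FiniteDimensional ℝ V] {m : ℕ} {f : (Fin m → ℝ) → V}
    {O K S : Set (Fin m → ℝ)} (hO : IsOpen O) (hf : ContDiffOn ℝ 1 f O) (hK : IsCompact K)
    (hKO : K ⊆ O) (hSK : S ⊆ K) (L : (⋀[ℝ]^m V) →ₗ[ℝ] ℝ) :
    L (directedVolume f S) = ∫ s in S, L (exteriorPower.ιMulti ℝ m (partialDeriv f s)) := by
  set b := Module.finBasis ℝ (⋀[ℝ]^m V) with hb
  have h1 : ∀ s, L (exteriorPower.ιMulti ℝ m (partialDeriv f s)) =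
      ∑ i, b.repr (exteriorPower.ιMulti ℝ m (partialDeriv f s)) i * L (b i) := by
    intro s
    conv_lhs => rw [← b.sum_repr (exteriorPower.ιMulti ℝ m (partialDeriv f s))]
    simp only [map_sum, map_smul, smul_eq_mul]
  simp only [h1]
  rw [integral_finsetSum]
  · simp only [directedVolume, ← hb, map_sum, map_smul, smul_eq_mul, integral_mul_const]
  · intro i _
    exact (integrableOn_alternatingMap hO hf hK hKO hSK
      ((b.coord i).compAlternatingMap (exteriorPower.ιMulti ℝ m))).mul_const _

theorem isOpen_tail {U : Set (Fin k → ℝ)} (hU : IsOpen U) :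
    IsOpen {s : Fin (k + 1) → ℝ | Fin.tail s ∈ U} :=
  hU.preimage (tailL k).continuous

theorem measurableSet_coneDomain {A : Set (Fin k → ℝ)} (hA : MeasurableSet A) :
    MeasurableSet (coneDomain A) :=
  ((measurable_pi_apply 0) measurableSet_Ioo).inter ((tailL k).continuous.measurable hA)

/-- The radial interval may be closed up to [0, 1], as the cone map stays C¹ across the apex
parameter `s 0 = 0`. -/
theorem exists_isCompact_coneDomain_subset {A U : Set (Fin k → ℝ)} (hA : IsCompact (closure A))
    (hAU : closure A ⊆ U) :
    ∃ K, IsCompact K ∧ coneDomain A ⊆ K ∧ K ⊆ {s : Fin (k + 1) → ℝ | Fin.tail s ∈ U} := by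
  refine ⟨(fun p : ℝ × (Fin k → ℝ) => (Fin.cons p.1 p.2 : Fin (k + 1) → ℝ)) ''
    (Icc 0 1 ×ˢ closure A), (isCompact_Icc.prod hA).image
      (Continuous.finCons continuous_fst continuous_snd), ?_, ?_⟩
  · intro s hs
    exact ⟨(s 0, Fin.tail s), ⟨Ioo_subset_Icc_self hs.1, subset_closure hs.2⟩, Fin.cons_self_tail s⟩
  · rintro _ ⟨p, hp, rfl⟩
    simpa using hAU hp.2

theorem IsLocalParam.contDiffOn_coneMap {N : Set V} {φ : (Fin k → ℝ) → V} {U : Set (Fin k → ℝ)}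
    (hφ : IsLocalParam N φ U) :
    ContDiffOn ℝ 1 (coneMap φ) {s : Fin (k + 1) → ℝ | Fin.tail s ∈ U} :=
  fun _ hs => (hφ.contDiffAt_coneMap hs).contDiffWithinAt

theorem IsLocalParam.apply_directedVolume_coneMap [FiniteDimensional ℝ V] {N : Set V}
    {φ : (Fin k → ℝ) → V} {U A : Set (Fin k → ℝ)}
    (hφ : IsLocalParam N φ U) (hA : IsCompact (closure A)) (hAU : closure A ⊆ U)
    (L : (⋀[ℝ]^(k + 1) V) →ₗ[ℝ] ℝ) :
    IntegrableOn (fun s => L (exteriorPower.ιMulti ℝ (k + 1) (partialDeriv (coneMap φ) s)))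
        (coneDomain A) ∧
      L (directedVolume (coneMap φ) (coneDomain A)) =
        ∫ s in coneDomain A, L (exteriorPower.ιMulti ℝ (k + 1) (partialDeriv (coneMap φ) s)) := by
  obtain ⟨K, hK, hSK, hKO⟩ := exists_isCompact_coneDomain_subset hA hAU
  exact ⟨integrableOn_alternatingMap (isOpen_tail hφ.isOpen_dom) hφ.contDiffOn_coneMap hK hKO hSK
      (L.compAlternatingMap (exteriorPower.ιMulti ℝ (k + 1))),
    apply_directedVolume (isOpen_tail hφ.isOpen_dom) hφ.contDiffOn_coneMap hK hKO hSK L⟩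

/-! ### The orthogonal projection along a frame -/

/-- The coordinates `x ↦ (⟨wⱼ, x⟩)ⱼ` of the orthogonal projection to the span of `w`. -/
def proj [FiniteDimensional ℝ V] (Q : QuadraticForm ℝ V) (w : Fin (k + 1) → V) :
    V →L[ℝ] (Fin (k + 1) → ℝ) :=
  LinearMap.toContinuousLinearMap (LinearMap.pi fun j => bil Q (w j))

theorem proj_apply [FiniteDimensional ℝ V] (w : Fin (k + 1) → V) (x : V) (j : Fin (k + 1)) :
    proj Q w x j = bil Q (w j) x := rfl

theorem IsLocalParam.hasFDerivAt_proj_coneMap [FiniteDimensional ℝ V] {N : Set V}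
    {φ : (Fin k → ℝ) → V} {U : Set (Fin k → ℝ)}
    (hφ : IsLocalParam N φ U) (w : Fin (k + 1) → V) {s : Fin (k + 1) → ℝ} (hs : Fin.tail s ∈ U) :
    HasFDerivAt (fun s => proj Q w (coneMap φ s)) ((proj Q w).comp (fderiv ℝ (coneMap φ) s)) s :=
  (proj Q w).hasFDerivAt.comp s
    ((hφ.contDiffAt_coneMap hs).differentiableAt one_ne_zero).hasFDerivAt

/-- Both sides are the determinant of the matrix ⟨∂ᵢf, wⱼ⟩, up to transposition. This links the
directed volume to Lebesgue measure. -/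
theorem det_proj_comp [FiniteDimensional ℝ V] (w : Fin (k + 1) → V)
    (f : (Fin (k + 1) → ℝ) → V) (s : Fin (k + 1) → ℝ) :
    ((proj Q w).comp (fderiv ℝ f s)).det =
      extInner Q (k + 1) (exteriorPower.ιMulti ℝ (k + 1) (partialDeriv f s))
        (exteriorPower.ιMulti ℝ (k + 1) w) := by
  rw [extInner_ιMulti, ContinuousLinearMap.det, ← LinearMap.det_toMatrix', ← Matrix.det_transpose]
  congr 1
  ext i j
  simp only [Matrix.transpose_apply, LinearMap.toMatrix'_apply, Matrix.of_apply]
  rw [← bil, bil_comm]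
  simp [proj_apply, partialDeriv]

/-- The projection of the cone over a piece has volume at most the corresponding component of the
directed volume, with equality if the projection is injective. -/
theorem IsLocalParam.volume_image_le [FiniteDimensional ℝ V] {N : Set V}
    {φ : (Fin k → ℝ) → V} {U A : Set (Fin k → ℝ)} (w : Fin (k + 1) → V)
    (hφ : IsLocalParam N φ U) (hAm : MeasurableSet A) (hA : IsCompact (closure A))
    (hAU : closure A ⊆ U) {σ : ℝ} (hσ : |σ| = 1)
    (hpos : ∀ u ∈ U, 0 < σ * extInner Q (k + 1) (coneTensor φ u)
      (exteriorPower.ιMulti ℝ (k + 1) w)) :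
    0 ≤ σ * extInner Q (k + 1) (directedVolume (coneMap φ) (coneDomain A))
          (exteriorPower.ιMulti ℝ (k + 1) w) ∧
    volume ((fun s => proj Q w (coneMap φ s)) '' coneDomain A) ≤
        ENNReal.ofReal (σ * extInner Q (k + 1) (directedVolume (coneMap φ) (coneDomain A))
          (exteriorPower.ιMulti ℝ (k + 1) w)) ∧
      (InjOn (fun s => proj Q w (coneMap φ s)) (coneDomain A) →
        volume ((fun s => proj Q w (coneMap φ s)) '' coneDomain A) =
        ENNReal.ofReal (σ * extInner Q (k + 1) (directedVolume (coneMap φ) (coneDomain A))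
          (exteriorPower.ιMulti ℝ (k + 1) w))) := by
  set L : (⋀[ℝ]^(k + 1) V) →ₗ[ℝ] ℝ :=
    σ • (extInner Q (k + 1)).flip (exteriorPower.ιMulti ℝ (k + 1) w) with hL
  have hLa : ∀ x, L x = σ * extInner Q (k + 1) x (exteriorPower.ιMulti ℝ (k + 1) w) := by
    intro x; simp [hL]
  obtain ⟨hint, hval⟩ := hφ.apply_directedVolume_coneMap hA hAU L
  have hnn : ∀ s ∈ coneDomain A,
      0 ≤ L (exteriorPower.ιMulti ℝ (k + 1) (partialDeriv (coneMap φ) s)) := by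
    intro s hs
    rw [hφ.ιMulti_coneMap (hAU (subset_closure hs.2)), map_smul, hLa, smul_eq_mul]
    exact mul_nonneg (pow_nonneg hs.1.1.le _) (hpos _ (hAU (subset_closure hs.2))).le
  have hmeas := measurableSet_coneDomain hAm
  have hd : ∀ s ∈ coneDomain A, HasFDerivWithinAt (fun s => proj Q w (coneMap φ s))
      ((proj Q w).comp (fderiv ℝ (coneMap φ) s)) (coneDomain A) s := fun s hs =>
    (hφ.hasFDerivAt_proj_coneMap w (hAU (subset_closure hs.2))).hasFDerivWithinAt
  have hlint : ∫⁻ s in coneDomain A,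
      ENNReal.ofReal |((proj Q w).comp (fderiv ℝ (coneMap φ) s)).det| =
      ENNReal.ofReal (L (directedVolume (coneMap φ) (coneDomain A))) := by
    rw [hval, ofReal_integral_eq_lintegral_ofReal hint]
    · refine setLIntegral_congr_fun hmeas fun s hs => ?_
      have := hnn s hs
      rw [det_proj_comp, ← abs_of_nonneg this, hLa, abs_mul, hσ, one_mul]
    · exact (ae_restrict_iff' hmeas).2 (Filter.Eventually.of_forall hnn)
  rw [← hLa]
  refine ⟨?_, ?_, fun hinj => ?_⟩
  · rw [hval]; exact setIntegral_nonneg hmeas hnn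
  · rw [← hlint]
    exact addHaar_image_le_lintegral_abs_det_fderiv volume hmeas hd
  · rw [← hlint]
    exact (lintegral_abs_det_fderiv_eq_addHaar_image volume hmeas hd hinj).symm

/-- The projection of the open cone over `N`. -/
def projCone [FiniteDimensional ℝ V] (Q : QuadraticForm ℝ V) (w : Fin (k + 1) → V) (N : Set V) :
    Set (Fin (k + 1) → ℝ) :=
  {y | ∃ t ∈ Ioo (0 : ℝ) 1, ∃ x ∈ N, y = t • proj Q w x}

theorem apply_units_smul (L : (⋀[ℝ]^(k + 1) V) →ₗ[ℝ] ℝ) (e : ℤˣ) (x : ⋀[ℝ]^(k + 1) V) :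
    L (e • x) = ((e : ℤ) : ℝ) * L x := by
  rw [Units.smul_def, map_zsmul, zsmul_eq_mul]

/-! ### The enclosed volume against the volume of the projected cone -/

namespace OrientedDecomposition

variable [FiniteDimensional ℝ V] {N : Set V} (D : OrientedDecomposition Q k N)

theorem iUnion_image_coneDomain (w : Fin (k + 1) → V) :
    ⋃ i, (fun s => proj Q w (coneMap (D.chart i) s)) '' coneDomain (D.piece i) =
      projCone Q w N := by
  ext y
  simp only [mem_iUnion, mem_image, projCone, mem_ofPred_eq]
  constructor
  · rintro ⟨i, s, hs, rfl⟩
    refine ⟨s 0, hs.1, D.chart i (Fin.tail s), ?_, by simp [coneMap]⟩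
    exact D.cover.subset (mem_iUnion.2 ⟨i, _, hs.2, rfl⟩)
  · rintro ⟨t, ht, x, hx, rfl⟩
    obtain ⟨i, u, hu, rfl⟩ := mem_iUnion.1 (D.cover.superset hx)
    exact ⟨i, Fin.cons t u, ⟨by simpa using ht, by simpa using hu⟩, by simp [coneMap]⟩

/-- The orientation condition compares cone tensors only with each other; `extInner_trans` transfers
it to the fixed tensor of `w`. One reference point then decides the global sign ε. -/
theorem exists_sign {ν : V} {w : Fin (k + 1) → V} (h : IsFrame Q ν w)
    (hdim : Module.finrank ℝ V = (k + 1) + 1) (hN : N ⊆ hyperboloid Q) (hs : IsSpacelike Q k N) :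
    ∃ ε : ℝ, |ε| = 1 ∧ ∀ i, ∀ u ∈ D.dom i, 0 < ε * ((D.sgn i : ℤ) : ℝ) *
      extInner Q (k + 1) (coneTensor (D.chart i) u) (exteriorPower.ιMulti ℝ (k + 1) w) := by
  set T := exteriorPower.ιMulti ℝ (k + 1) w
  have hT : 0 < energy Q T := by rw [h.energy_frame]; exact one_pos
  by_cases hne : ∃ i, (D.dom i).Nonempty
  · obtain ⟨i₀, u₀, hu₀⟩ := hne
    have hpos : ∀ i, ∀ u ∈ D.dom i,
        0 < (((D.sgn i : ℤ) : ℝ) * extInner Q (k + 1) (coneTensor (D.chart i) u) T) *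
          (((D.sgn i₀ : ℤ) : ℝ) * extInner Q (k + 1) (coneTensor (D.chart i₀) u₀) T) := by
      intro i u hu
      have h1 := D.oriented i i₀ u hu u₀ hu₀
      rw [apply_units_smul, ← LinearMap.flip_apply, apply_units_smul, LinearMap.flip_apply] at h1
      have h2 := h.extInner_trans hdim hT
        ((D.isLocalParam i).energy_coneTensor_pos hN hs hu)
        ((D.isLocalParam i₀).energy_coneTensor_pos hN hs hu₀)
      have h3 := mul_pos h1 h2
      set p := extInner Q (k + 1) (coneTensor (D.chart i) u) (coneTensor (D.chart i₀) u₀)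
      -- The product of `h1` and `h2` is the goal times `p ^ 2`.
      refine pos_of_mul_pos_right (a := p ^ 2) ?_ (sq_nonneg _)
      refine h3.trans_le (le_of_eq ?_)
      ring
    refine ⟨SignType.sign (((D.sgn i₀ : ℤ) : ℝ) *
      extInner Q (k + 1) (coneTensor (D.chart i₀) u₀) T), ?_, fun i u hu => ?_⟩
    · have := hpos i₀ u₀ hu₀
      rcases lt_trichotomy (((D.sgn i₀ : ℤ) : ℝ) *
        extInner Q (k + 1) (coneTensor (D.chart i₀) u₀) T) 0 with h0 | h0 | h0
      · simp [sign_neg h0]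
      · rw [h0] at this; simp at this
      · simp [sign_pos h0]
    · have := hpos i u hu
      rw [mul_assoc, mul_comm]
      rcases lt_trichotomy (((D.sgn i₀ : ℤ) : ℝ) *
        extInner Q (k + 1) (coneTensor (D.chart i₀) u₀) T) 0 with h0 | h0 | h0
      · rw [sign_neg h0]; simpa using neg_of_mul_pos_left this h0.le
      · rw [h0] at this; simp at this
      · rw [sign_pos h0]; simpa using pos_of_mul_pos_left this h0.le
  · push Not at hne
    refine ⟨1, abs_one, fun i u hu => ?_⟩
    rw [hne i] at hu
    exact hu.elim

/-- After multiplication by ε every piece contributes nonnegatively, so the absolute value of the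
sum is the sum of the contributions. Overlaps can then only reduce the volume of the union. -/
theorem volume_projCone_le {ν : V} {w : Fin (k + 1) → V} (h : IsFrame Q ν w)
    (hdim : Module.finrank ℝ V = (k + 1) + 1) (hN : N ⊆ hyperboloid Q) (hs : IsSpacelike Q k N) :
    volume (projCone Q w N) ≤ ENNReal.ofReal
      |extInner Q (k + 1) D.enclosedVolume (exteriorPower.ιMulti ℝ (k + 1) w)| ∧
    ((∀ i, InjOn (fun s => proj Q w (coneMap (D.chart i) s)) (coneDomain (D.piece i))) →
      (Pairwise fun i j => Disjoint
        ((fun s => proj Q w (coneMap (D.chart i) s)) '' coneDomain (D.piece i))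
        ((fun s => proj Q w (coneMap (D.chart j) s)) '' coneDomain (D.piece j))) →
      volume (projCone Q w N) = ENNReal.ofReal
      |extInner Q (k + 1) D.enclosedVolume (exteriorPower.ιMulti ℝ (k + 1) w)|) := by
  obtain ⟨ε, hε, hpos⟩ := D.exists_sign h hdim hN hs
  set T := exteriorPower.ιMulti ℝ (k + 1) w with hT
  have hσ : ∀ i, |ε * ((D.sgn i : ℤ) : ℝ)| = 1 := by
    intro i
    rw [abs_mul, hε, one_mul]
    rcases Int.units_eq_one_or (D.sgn i) with h | h <;> simp [h]
  have key := fun i => (D.isLocalParam i).volume_image_le w (D.measurableSet_piece i)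
    (D.isCompact_closure i) (D.closure_subset i) (hσ i) (hpos i)
  have hsum : ENNReal.ofReal |extInner Q (k + 1) D.enclosedVolume T| =
      ∑ i, ENNReal.ofReal (ε * ((D.sgn i : ℤ) : ℝ) * extInner Q (k + 1)
        (directedVolume (coneMap (D.chart i)) (coneDomain (D.piece i))) T) := by
    rw [← ENNReal.ofReal_sum_of_nonneg fun i _ => (key i).1]
    congr 1
    have : ∑ i, ε * ((D.sgn i : ℤ) : ℝ) * extInner Q (k + 1)
        (directedVolume (coneMap (D.chart i)) (coneDomain (D.piece i))) T =
        ε * extInner Q (k + 1) D.enclosedVolume T := by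
      rw [← LinearMap.flip_apply, enclosedVolume, map_sum, Finset.mul_sum]
      refine Finset.sum_congr rfl fun i _ => ?_
      rw [apply_units_smul, LinearMap.flip_apply, mul_assoc]
    have h2 : 0 ≤ ε * extInner Q (k + 1) D.enclosedVolume T := by
      rw [← this]; exact Finset.sum_nonneg fun i _ => (key i).1
    rw [this, ← abs_of_nonneg h2, abs_mul, hε, one_mul]
  rw [hsum, ← D.iUnion_image_coneDomain w]
  refine ⟨(measure_iUnion_le _).trans ?_, fun hinj hdisj => ?_⟩
  · rw [tsum_fintype]
    exact Finset.sum_le_sum fun i _ => (key i).2.1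
  · rw [measure_iUnion hdisj, tsum_fintype]
    · exact Finset.sum_congr rfl fun i _ => (key i).2.2 (hinj i)
    · intro i
      exact measurable_image_of_fderivWithin (measurableSet_coneDomain (D.measurableSet_piece i))
        (fun s hs => ((D.isLocalParam i).hasFDerivAt_proj_coneMap w
          (D.closure_subset i (subset_closure hs.2))).hasFDerivWithinAt) (hinj i)

end OrientedDecomposition

section Surround

/-! ### The projection of a neck surrounds the origin -/

open Topology

variable {N : Set V} {ν : V} {w : Fin (k + 1) → V}

/-- The homotopy inverse sends the point `w 0` of the hyperboloid into N. -/
theorem IsNeck.nonempty (hN : IsNeck Q k N) (h : IsFrame Q ν w) : N.Nonempty := by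
  obtain ⟨e, -⟩ := hN.homotopyEquiv
  exact ⟨_, (e.invFun ⟨w 0, by rw [hyperboloid, mem_ofPred_eq, ← bil_self, h.gram]; simp⟩).2⟩

/-- All k + 2 vectors lie in the hyperplane orthogonal to ν. -/
theorem IsFrame.wedgeDet_eq_zero (h : IsFrame Q ν w) (hdim : Module.finrank ℝ V = (k + 1) + 1)
    (j : Fin (k + 1)) {v : Fin (k + 1) → V} (hv : ∀ i, bil Q ν (v i) = 0) :
    wedgeDet (h.basis hdim) (w j) (exteriorPower.ιMulti ℝ (k + 1) v) = 0 := by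
  rw [wedgeDet_ιMulti]
  have h1 := h.det_gram hdim (Fin.cons (w j) v) (Fin.cons ν w)
  rw [← h.coe_basis hdim, Module.Basis.det_self, mul_one,
    Matrix.det_eq_zero_of_column_eq_zero 0] at h1
  · linarith
  · intro i
    rw [Matrix.of_apply, h.coe_basis, Fin.cons_zero, bil_comm]
    refine Fin.cases ?_ (fun i => ?_) i
    · exact h.orth j
    · exact hv i

variable [FiniteDimensional ℝ V]

theorem IsFrame.sum_proj_sq (h : IsFrame Q ν w) (hdim : Module.finrank ℝ V = (k + 1) + 1) {x : V}
    (hx : x ∈ hyperboloid Q) : ∑ j, proj Q w x j ^ 2 = 1 + bil Q ν x ^ 2 := by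
  have h1 : Q x = 1 := hx
  have := h.apply_eq hdim x
  simp only [proj_apply]
  linarith

theorem IsFrame.proj_ne_zero (h : IsFrame Q ν w) (hdim : Module.finrank ℝ V = (k + 1) + 1) {x : V}
    (hx : x ∈ hyperboloid Q) : proj Q w x ≠ 0 := by
  intro h0
  have := h.sum_proj_sq hdim hx
  rw [h0] at this
  simp only [Pi.zero_apply, ne_eq, OfNat.ofNat_ne_zero, not_false_eq_true, zero_pow,
    Finset.sum_const_zero] at this
  nlinarith [sq_nonneg (bil Q ν x)]

/-- Inverse function theorem: the Jacobian is a positive power of the radius times a pairing of two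
spacelike tensors, which cannot vanish. -/
theorem IsLocalParam.map_nhds_proj_coneMap {φ : (Fin k → ℝ) → V} {U : Set (Fin k → ℝ)}
    (hφ : IsLocalParam N φ U) (h : IsFrame Q ν w) (hdim : Module.finrank ℝ V = (k + 1) + 1)
    (hN : N ⊆ hyperboloid Q) (hs : IsSpacelike Q k N) {s : Fin (k + 1) → ℝ} (hs0 : 0 < s 0)
    (hsU : Fin.tail s ∈ U) :
    Filter.map (fun s => proj Q w (coneMap φ s)) (𝓝 s) = 𝓝 (proj Q w (coneMap φ s)) := by
  have hdet : ((proj Q w).comp (fderiv ℝ (coneMap φ) s)).det ≠ 0 := by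
    rw [det_proj_comp, hφ.ιMulti_coneMap hsU, map_smul, LinearMap.smul_apply, smul_eq_mul]
    have hc := hφ.energy_coneTensor_pos hN hs hsU
    have := h.extInner_trans hdim (by rw [h.energy_frame]; exact one_pos) hc hc
    refine mul_ne_zero (pow_ne_zero _ hs0.ne') fun h0 => ?_
    rw [h0] at this
    simp at this
  have hstrict : HasStrictFDerivAt (fun s => proj Q w (coneMap φ s))
      (((proj Q w).comp (fderiv ℝ (coneMap φ) s)).toContinuousLinearEquivOfDetNeZero hdet :
        (Fin (k + 1) → ℝ) →L[ℝ] (Fin (k + 1) → ℝ)) s := by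
    rw [ContinuousLinearMap.coe_toContinuousLinearEquivOfDetNeZero]
    exact (proj Q w).hasStrictFDerivAt.comp s
      ((hφ.contDiffAt_coneMap hsU).hasStrictFDerivAt one_ne_zero)
  exact hstrict.map_nhds_eq_of_equiv

/-- The projection of the cone over an open set of radii is open. -/
theorem IsNeck.isOpen_proj (hN : IsNeck Q k N) (h : IsFrame Q ν w)
    (hdim : Module.finrank ℝ V = (k + 1) + 1) {I : Set ℝ} (hI : IsOpen I) (hI0 : ∀ t ∈ I, 0 < t) :
    IsOpen {y | ∃ t ∈ I, ∃ x ∈ N, y = t • proj Q w x} := by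
  rw [isOpen_iff_mem_nhds]
  rintro _ ⟨t, ht, x, hx, rfl⟩
  obtain ⟨φ, U, hφ, u, hu, rfl⟩ := hN.submanifold.2 x hx
  have hm := hφ.map_nhds_proj_coneMap h hdim hN.subset hN.spacelike
    (s := Fin.cons t u) (by simpa using hI0 t ht) (by simpa using hu)
  have hval : proj Q w (coneMap φ (Fin.cons t u)) = t • proj Q w (φ u) := by simp [coneMap]
  rw [hval] at hm
  rw [← hm, Filter.mem_map]
  have h1 : {s : Fin (k + 1) → ℝ | s 0 ∈ I ∧ Fin.tail s ∈ U} ∈ 𝓝 (Fin.cons t u) :=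
    ((hI.preimage (continuous_apply 0)).inter (isOpen_tail hφ.isOpen_dom)).mem_nhds
      ⟨by simpa using ht, by simpa using hu⟩
  filter_upwards [h1] with s hs
  exact ⟨s 0, hs.1, _, hφ.mem hs.2, by simp [coneMap]⟩

/-- The union of rays met by the projection is open by `isOpen_proj` and, N being compact, closed in
the punctured space. That space is connected because its dimension k + 1 is at least 2. -/
theorem IsNeck.exists_smul_proj_of_pos (hN : IsNeck Q k N) (h : IsFrame Q ν w)
    (hdim : Module.finrank ℝ V = (k + 1) + 1) (hk : 0 < k) {y : Fin (k + 1) → ℝ} (hy : y ≠ 0) :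
    ∃ t ∈ Ioi (0 : ℝ), ∃ x ∈ N, y = t • proj Q w x := by
  set C : Set (Fin (k + 1) → ℝ) := {y | ∃ t ∈ Ioi (0 : ℝ), ∃ x ∈ N, y = t • proj Q w x} with hC
  have hCo : IsOpen C := hN.isOpen_proj h hdim isOpen_Ioi fun _ ht => ht
  set R : Set (Fin (k + 1) → ℝ) := (fun x => ‖proj Q w x‖⁻¹ • proj Q w x) '' N
  have hnorm : ∀ x ∈ N, 0 < ‖proj Q w x‖ := fun x hx =>
    norm_pos_iff.2 (h.proj_ne_zero hdim (hN.subset hx))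
  have hR : IsCompact R := by
    have h1 : ContinuousOn (fun x => ‖proj Q w x‖⁻¹) N :=
      (proj Q w).continuous.norm.continuousOn.inv₀ fun x hx => (hnorm x hx).ne'
    exact hN.submanifold.1.image_of_continuousOn (h1.smul (proj Q w).continuous.continuousOn)
  have hiff : ∀ z : Fin (k + 1) → ℝ, z ≠ 0 → (z ∈ C ↔ ‖z‖⁻¹ • z ∈ R) := by
    intro z hz
    have hz0 := norm_pos_iff.2 hz
    constructor
    · rintro ⟨t, ht, x, hx, rfl⟩
      refine ⟨x, hx, ?_⟩
      have ht0 : (0 : ℝ) < t := ht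
      have := hnorm x hx
      simp only [norm_smul, Real.norm_eq_abs, abs_of_pos ht0, smul_smul]
      congr 1
      field_simp
    · rintro ⟨x, hx, hxz⟩
      refine ⟨‖z‖ * ‖proj Q w x‖⁻¹, mul_pos hz0 (inv_pos.2 (hnorm x hx)), x, hx, ?_⟩
      have hxz' : ‖proj Q w x‖⁻¹ • proj Q w x = ‖z‖⁻¹ • z := hxz
      rw [mul_smul, hxz', smul_inv_smul₀ hz0.ne']
  have hconn : IsConnected ({0}ᶜ : Set (Fin (k + 1) → ℝ)) := by
    apply isConnected_compl_singleton_of_one_lt_rank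
    rw [← Module.finrank_eq_rank, Module.finrank_fin_fun]
    exact_mod_cast Nat.lt_add_of_pos_left hk
  have : PreconnectedSpace ({0}ᶜ : Set (Fin (k + 1) → ℝ)) :=
    Subtype.preconnectedSpace hconn.isPreconnected
  set C' : Set ({0}ᶜ : Set (Fin (k + 1) → ℝ)) := Subtype.val ⁻¹' C
  have hclosed : IsClosed C' := by
    have : C' = (fun z : ({0}ᶜ : Set (Fin (k + 1) → ℝ)) => ‖(z : Fin (k + 1) → ℝ)‖⁻¹ •
        (z : Fin (k + 1) → ℝ)) ⁻¹' R := by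
      ext z
      exact hiff z z.2
    rw [this]
    have h1 : Continuous fun z : ({0}ᶜ : Set (Fin (k + 1) → ℝ)) => ‖(z : Fin (k + 1) → ℝ)‖⁻¹ :=
      continuous_subtype_val.norm.inv₀ fun z => norm_ne_zero_iff.2 z.2
    exact hR.isClosed.preimage (h1.smul continuous_subtype_val)
  have hclopen : IsClopen C' := ⟨hclosed, hCo.preimage continuous_subtype_val⟩
  have hne : C'.Nonempty := by
    obtain ⟨x, hx⟩ := hN.nonempty h
    exact ⟨⟨proj Q w x, h.proj_ne_zero hdim (hN.subset hx)⟩, 1,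
      mem_Ioi.2 one_pos, x, hx, (one_smul _ _).symm⟩
  have := hclopen.eq_univ hne
  exact (this.superset (mem_univ (⟨y, hy⟩ : ({0}ᶜ : Set (Fin (k + 1) → ℝ)))))

/-- The punctured line is disconnected, so here the homotopy equivalence does the work. The homotopy
joins a point of N to ±`w 0` inside the hyperboloid, where the single coordinate never vanishes and
so keeps its sign. -/
theorem IsNeck.exists_smul_proj_of_eq_zero {w : Fin (0 + 1) → V} (hN : IsNeck Q 0 N)
    (h : IsFrame Q ν w) (hdim : Module.finrank ℝ V = (0 + 1) + 1)
    {y : Fin (0 + 1) → ℝ} (hy : y ≠ 0) :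
    ∃ t ∈ Ioi (0 : ℝ), ∃ x ∈ N, y = t • proj Q w x := by
  have hi : ∀ i : Fin (0 + 1), i = 0 := Fin.fin_one_eq_zero
  have hy0 : y 0 ≠ 0 := by
    intro h0; apply hy; ext i; rw [hi i, h0]; rfl
  have hne : ∀ x ∈ hyperboloid Q, proj Q w x 0 ≠ 0 := by
    intro x hx h0
    apply h.proj_ne_zero hdim hx
    ext i; rw [hi i, h0]; rfl
  have hw : Q (w 0) = 1 := by rw [← bil_self, h.gram]; simp
  set z : V := (SignType.sign (y 0) : ℝ) • w 0 with hz
  have hsq : (SignType.sign (y 0) : ℝ) * (SignType.sign (y 0) : ℝ) = 1 := by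
    rcases lt_or_gt_of_ne hy0 with h0 | h0
    · simp [sign_neg h0]
    · simp [sign_pos h0]
  have hzH : z ∈ hyperboloid Q := by
    change Q z = 1
    rw [hz, QuadraticMap.map_smul, hw, hsq]; simp
  have hzp : 0 < proj Q w z 0 * y 0 := by
    rw [proj_apply, hz, map_smul, h.gram]
    simp only [if_true, smul_eq_mul, mul_one, sign_mul_self]
    exact abs_pos.2 hy0
  obtain ⟨e, he⟩ := hN.homotopyEquiv
  obtain ⟨G⟩ := e.right_inv
  set x : N := e.invFun ⟨z, hzH⟩ with hx
  have h0 : G (0, ⟨z, hzH⟩) = Set.inclusion hN.subset x := by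
    rw [G.apply_zero, ← he]; rfl
  have h1 : G (1, ⟨z, hzH⟩) = ⟨z, hzH⟩ := by
    rw [G.apply_one]; rfl
  have hcont : Continuous fun s : unitInterval => proj Q w (G (s, ⟨z, hzH⟩)) 0 * y 0 := by
    fun_prop
  have hxp : 0 < proj Q w (x : V) 0 * y 0 := by
    by_contra hcon
    obtain ⟨s, hs⟩ := mem_range_of_exists_le_of_exists_ge hcont (c := 0)
      ⟨0, by rw [h0]; exact not_lt.1 hcon⟩ ⟨1, by rw [h1]; exact hzp.le⟩
    exact mul_ne_zero (hne _ (G (s, ⟨z, hzH⟩)).2) hy0 hs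
  have hx0 : proj Q w (x : V) 0 ≠ 0 := hne _ (hN.subset x.2)
  refine ⟨y 0 / proj Q w (x : V) 0, ?_, x, x.2, ?_⟩
  · rw [mem_Ioi]
    have : y 0 / proj Q w (x : V) 0 = (proj Q w (x : V) 0 * y 0) / (proj Q w (x : V) 0) ^ 2 := by
      field_simp
    rw [this]; positivity
  · ext i
    rw [hi i]
    simp [hx0]

/-- Every ray of the hyperplane meets the projection of a neck. -/
theorem IsNeck.exists_smul_proj (hN : IsNeck Q k N) (h : IsFrame Q ν w)
    (hdim : Module.finrank ℝ V = (k + 1) + 1) {y : Fin (k + 1) → ℝ} (hy : y ≠ 0) :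
    ∃ t ∈ Ioi (0 : ℝ), ∃ x ∈ N, y = t • proj Q w x := by
  rcases Nat.eq_zero_or_pos k with rfl | hk
  · exact hN.exists_smul_proj_of_eq_zero h hdim hy
  · exact hN.exists_smul_proj_of_pos h hdim hk hy

/-- The Euclidean unit ball in coordinates. -/
def coordBall (n : ℕ) : Set (Fin n → ℝ) := {y | ∑ j, y j ^ 2 < 1}

theorem continuous_sum_sq (n : ℕ) : Continuous fun y : Fin n → ℝ => ∑ j, y j ^ 2 := by
  fun_prop

theorem unitBallVolume_pos (k : ℕ) : 0 < unitBallVolume (k + 1) :=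
  ENNReal.toReal_pos (Metric.measure_ball_pos _ _ one_pos).ne' measure_ball_lt_top.ne

theorem volume_coordBall (n : ℕ) : volume (coordBall n) = ENNReal.ofReal (unitBallVolume n) := by
  rw [unitBallVolume, ENNReal.ofReal_toReal measure_ball_lt_top.ne,
    ← (EuclideanSpace.volume_preserving_symm_measurableEquiv_toLp (Fin n)).measure_preimage_equiv]
  congr 1
  ext y
  simp [coordBall, EuclideanSpace.norm_eq, Real.sqrt_lt' one_pos]

/-- A ray reaches the projection of N at distance at least 1, so a point inside the ball has
parameter t < 1. -/
theorem IsNeck.coordBall_subset (hN : IsNeck Q k N) (h : IsFrame Q ν w)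
    (hdim : Module.finrank ℝ V = (k + 1) + 1) : coordBall (k + 1) \ {0} ⊆ projCone Q w N := by
  rintro y ⟨hy, hy0⟩
  obtain ⟨t, ht, x, hx, rfl⟩ := hN.exists_smul_proj h hdim hy0
  have ht0 : 0 < t := ht
  refine ⟨t, ⟨ht0, ?_⟩, x, hx, rfl⟩
  have h1 := h.sum_proj_sq hdim (hN.subset hx)
  have h2 : ∑ j, (t • proj Q w x) j ^ 2 < 1 := hy
  simp only [Pi.smul_apply, smul_eq_mul, mul_pow] at h2
  rw [← Finset.mul_sum, h1] at h2
  nlinarith [sq_nonneg (t * bil Q ν x)]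

theorem volume_coordBall_diff (k : ℕ) :
    volume (coordBall (k + 1) \ {0}) = ENNReal.ofReal (unitBallVolume (k + 1)) := by
  rw [measure_sdiff_null (measure_singleton _), volume_coordBall]

theorem IsNeck.le_volume_projCone (hN : IsNeck Q k N) (h : IsFrame Q ν w)
    (hdim : Module.finrank ℝ V = (k + 1) + 1) :
    ENNReal.ofReal (unitBallVolume (k + 1)) ≤ volume (projCone Q w N) := by
  rw [← volume_coordBall_diff]
  exact measure_mono (hN.coordBall_subset h hdim)

/-- The part of the projected cone outside the closed ball is open, so it has positive volume once
it is nonempty. -/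
theorem IsNeck.lt_volume_projCone (hN : IsNeck Q k N) (h : IsFrame Q ν w)
    (hdim : Module.finrank ℝ V = (k + 1) + 1) {x : V} (hx : x ∈ N) (hxν : bil Q ν x ≠ 0) :
    ENNReal.ofReal (unitBallVolume (k + 1)) < volume (projCone Q w N) := by
  set G : Set (Fin (k + 1) → ℝ) := projCone Q w N ∩ {y | 1 < ∑ j, y j ^ 2} with hG
  have hGo : IsOpen G := (hN.isOpen_proj h hdim isOpen_Ioo fun _ ht => ht.1).inter
    (isOpen_lt continuous_const (continuous_sum_sq _))
  have hGne : G.Nonempty := by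
    have h1 := h.sum_proj_sq hdim (hN.subset hx)
    have hτ : 0 < bil Q ν x ^ 2 := by positivity
    set A := 1 + bil Q ν x ^ 2
    have hA : 1 < A := by linarith
    -- The scalar must lie strictly between A^(-1/2) and 1; by AM-GM the mean of 1 and A⁻¹ does,
    -- without a square root.
    refine ⟨((1 + A⁻¹) / 2) • proj Q w x, ⟨(1 + A⁻¹) / 2, ⟨by positivity, ?_⟩, x, hx, rfl⟩, ?_⟩
    · have := inv_lt_one_of_one_lt₀ hA
      linarith
    · change 1 < ∑ j, (((1 + A⁻¹) / 2) • proj Q w x) j ^ 2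
      simp only [Pi.smul_apply, smul_eq_mul, mul_pow]
      rw [← Finset.mul_sum, h1]
      have hA0 : 0 < A := by linarith
      have : ((1 + A⁻¹) / 2) ^ 2 * A = 1 + (A - 1) ^ 2 / (4 * A) := by
        field_simp; ring
      rw [this]
      have : 0 < (A - 1) ^ 2 / (4 * A) := by
        have : 0 < A - 1 := by linarith
        positivity
      linarith
  have hdisj : Disjoint (coordBall (k + 1) \ {0}) G := by
    rw [Set.disjoint_left]
    rintro y ⟨hy, -⟩ ⟨-, hy'⟩
    rw [mem_ofPred_eq] at hy'
    exact lt_asymm hy hy'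
  calc ENNReal.ofReal (unitBallVolume (k + 1))
      < ENNReal.ofReal (unitBallVolume (k + 1)) + volume G :=
        ENNReal.lt_add_right ENNReal.ofReal_ne_top (hGo.measure_pos _ hGne).ne'
    _ = volume ((coordBall (k + 1) \ {0}) ∪ G) := by
        rw [measure_union hdisj hGo.measurableSet, volume_coordBall_diff]
    _ ≤ volume (projCone Q w N) :=
        measure_mono (union_subset (hN.coordBall_subset h hdim) inter_subset_left)

theorem IsNeck.volume_projCone_eq (hN : IsNeck Q k N) (h : IsFrame Q ν w)
    (hdim : Module.finrank ℝ V = (k + 1) + 1) (hNν : ∀ x ∈ N, bil Q ν x = 0) :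
    volume (projCone Q w N) = ENNReal.ofReal (unitBallVolume (k + 1)) := by
  refine le_antisymm ?_ (hN.le_volume_projCone h hdim)
  rw [← volume_coordBall]
  refine measure_mono ?_
  rintro _ ⟨t, ht, x, hx, rfl⟩
  have h1 := h.sum_proj_sq hdim (hN.subset hx)
  change ∑ j, (t • proj Q w x) j ^ 2 < 1
  simp only [Pi.smul_apply, smul_eq_mul, mul_pow]
  rw [← Finset.mul_sum, h1, hNν x hx]
  nlinarith [ht.1, ht.2]

/-- A neck contained in a hyperplane is the whole section of the hyperboloid. -/
theorem IsNeck.eq_inter (hN : IsNeck Q k N) (h : IsFrame Q ν w)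
    (hdim : Module.finrank ℝ V = (k + 1) + 1) (hNν : ∀ x ∈ N, bil Q ν x = 0) :
    N = ↑(LinearMap.ker (bil Q ν)) ∩ hyperboloid Q := by
  refine Subset.antisymm (fun x hx => ⟨hNν x hx, hN.subset hx⟩) ?_
  rintro z ⟨hz, hzH⟩
  have hz' : bil Q ν z = 0 := hz
  obtain ⟨t, ht, x, hx, hxz⟩ := hN.exists_smul_proj h hdim (h.proj_ne_zero hdim hzH)
  have ht0 : 0 < t := ht
  have h1 : z - t • x = 0 := by
    refine h.eq_zero hdim ?_ fun j => ?_
    · rw [map_sub, map_smul, hz', hNν x hx]; simp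
    · have := congrFun hxz j
      simp only [proj_apply, Pi.smul_apply] at this
      rw [map_sub, map_smul, this, sub_self]
  rw [sub_eq_zero] at h1
  have h2 : Q z = 1 := hzH
  have h3 : Q x = 1 := hN.subset hx
  rw [h1, QuadraticMap.map_smul, h3, smul_eq_mul, mul_one] at h2
  have : t = 1 := by nlinarith
  rw [h1, this, one_smul]
  exact hx

/-! ### The inequality -/

namespace OrientedDecomposition

theorem unitBallVolume_le_extInner (hN : IsNeck Q k N) (D : OrientedDecomposition Q k N)
    (h : IsFrame Q ν w) (hdim : Module.finrank ℝ V = (k + 1) + 1) :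
    unitBallVolume (k + 1) ≤
        |extInner Q (k + 1) D.enclosedVolume (exteriorPower.ιMulti ℝ (k + 1) w)| ∧
      (|extInner Q (k + 1) D.enclosedVolume (exteriorPower.ιMulti ℝ (k + 1) w)| =
        unitBallVolume (k + 1) → ∀ x ∈ N, bil Q ν x = 0) := by
  have h1 := (D.volume_projCone_le h hdim hN.subset hN.spacelike).1
  refine ⟨?_, fun heq x hx => ?_⟩
  · exact (ENNReal.ofReal_le_ofReal_iff (abs_nonneg _)).1 ((hN.le_volume_projCone h hdim).trans h1)
  · by_contra hxν
    have := (hN.lt_volume_projCone h hdim hx hxν).trans_le h1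
    rw [heq] at this
    exact lt_irrefl _ this

theorem sq_le_energy (hN : IsNeck Q k N) (D : OrientedDecomposition Q k N)
    (h : IsFrame Q ν w) (hdim : Module.finrank ℝ V = (k + 1) + 1) :
    unitBallVolume (k + 1) ^ 2 ≤ energy Q D.enclosedVolume ∧
      (energy Q D.enclosedVolume = unitBallVolume (k + 1) ^ 2 →
        ∃ a : V, bil Q a a = -1 ∧ N = ↑(LinearMap.ker (bil Q a)) ∩ hyperboloid Q) := by
  obtain ⟨h1, h2⟩ := h.le_energy hdim D.enclosedVolume (unitBallVolume_pos k)
    fun a u hu => (D.unitBallVolume_le_extInner hN hu hdim).1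
  refine ⟨h1, fun heq => ?_⟩
  obtain ⟨a, u, hu, hau⟩ := h2 heq
  exact ⟨a, hu.timelike, hN.eq_inter hu hdim ((D.unitBallVolume_le_extInner hN hu hdim).2 hau)⟩

end OrientedDecomposition

/-! ### The case of equality -/

/-- A functional vanishing on W is constant along φ, so it also kills the derivative. -/
theorem IsLocalParam.fderiv_mem {φ : (Fin k → ℝ) → V} {U : Set (Fin k → ℝ)}
    (hφ : IsLocalParam N φ U) {W : Submodule ℝ V} (hNW : N ⊆ W) {u : Fin k → ℝ} (hu : u ∈ U)
    (v : Fin k → ℝ) : fderiv ℝ φ u v ∈ W := by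
  by_contra hcon
  obtain ⟨f, hf, hfW⟩ := W.exists_le_ker_of_notMem hcon
  have h1 : HasFDerivAt (fun u => f (φ u)) _ u :=
    (LinearMap.toContinuousLinearMap f).hasFDerivAt.comp u (hφ.hasFDerivAt hu)
  have h2 : HasFDerivAt (fun u => f (φ u)) (0 : (Fin k → ℝ) →L[ℝ] ℝ) u := by
    refine (hasFDerivAt_const (0 : ℝ) u).congr_of_eventuallyEq ?_
    filter_upwards [hφ.isOpen_dom.mem_nhds hu] with x hx
    exact hfW (hNW (hφ.mem hx))
  exact hf (congrArg (fun L => L v) (h1.unique h2))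

/-- A hyperplane containing a neck is spacelike. -/
theorem IsNeck.pos_of_subset (hN : IsNeck Q k N) (h : IsFrame Q ν w) {W : Submodule ℝ V}
    (hW : Module.finrank ℝ W = k + 1) (hNW : N ⊆ W) : ∀ x ∈ W, x ≠ 0 → 0 < Q x := by
  obtain ⟨x, hx⟩ := hN.nonempty h
  obtain ⟨φ, U, hφ, u, hu, rfl⟩ := hN.submanifold.2 x hx
  set L : (ℝ × (Fin k → ℝ)) →ₗ[ℝ] V :=
    ((LinearMap.id : ℝ →ₗ[ℝ] ℝ).smulRight (φ u)).coprod (fderiv ℝ φ u).toLinearMap with hL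
  have hLa : ∀ p : ℝ × (Fin k → ℝ), L p = p.1 • φ u + fderiv ℝ φ u p.2 := by
    intro p; simp [hL]
  have hpos : ∀ p, p ≠ 0 → 0 < Q (L p) := by
    intro p hp
    rw [hLa]
    refine hφ.spacelike_cone hN.subset hN.spacelike hu ?_
    by_contra hcon
    push Not at hcon
    exact hp (Prod.ext hcon.1 hcon.2)
  have hinj : Function.Injective L := by
    rw [← LinearMap.ker_eq_bot, LinearMap.ker_eq_bot']
    intro p hp
    by_contra hp0
    have := hpos p hp0
    rw [hp] at this
    simp at this
  -- The position vector and the tangent space at one point already fill W by dimension.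
  have hrange : LinearMap.range L = W := by
    apply Submodule.eq_of_le_of_finrank_eq
    · rintro _ ⟨p, rfl⟩
      rw [hLa]
      exact W.add_mem (W.smul_mem _ (hNW (hφ.mem hu))) (hφ.fderiv_mem hNW hu _)
    · rw [LinearMap.finrank_range_of_inj hinj, hW]
      simp [add_comm]
  intro x hx hx0
  rw [← hrange] at hx
  obtain ⟨p, rfl⟩ := hx
  exact hpos p (by rintro rfl; simp at hx0)

/-- On the hyperplane orthogonal to ν the projection loses nothing, and `Q` recovers the squared
radius. This gives both injectivity on each piece and disjointness of the projected pieces. -/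
theorem IsFrame.smul_eq_smul (h : IsFrame Q ν w) (hdim : Module.finrank ℝ V = (k + 1) + 1)
    {x y : V} {s t : ℝ} (hs : 0 < s) (ht : 0 < t) (hx : x ∈ hyperboloid Q) (hy : y ∈ hyperboloid Q)
    (hxν : bil Q ν x = 0) (hyν : bil Q ν y = 0)
    (hxy : proj Q w (s • x) = proj Q w (t • y)) : s = t ∧ x = y := by
  have h1 : s • x - t • y = 0 := by
    refine h.eq_zero hdim ?_ fun j => ?_
    · rw [map_sub, map_smul, map_smul, hxν, hyν]; simp
    · have := congrFun hxy j
      simp only [proj_apply] at this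
      rw [map_sub, this, sub_self]
  rw [sub_eq_zero] at h1
  have hx1 : Q x = 1 := hx
  have hy1 : Q y = 1 := hy
  have h2 := congrArg Q h1
  rw [QuadraticMap.map_smul, QuadraticMap.map_smul, hx1, hy1, smul_eq_mul, smul_eq_mul, mul_one,
    mul_one] at h2
  have hst : s = t := by nlinarith
  subst hst
  exact ⟨rfl, smul_right_injective V hs.ne' h1⟩

namespace OrientedDecomposition

/-- The cone lies in one hyperplane, so ω has a component only along w₀ ∧ ⋯ ∧ wₖ. That component is
exactly the volume of the projected cone, which here has the volume of the ball. -/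
theorem energy_eq_of_subset (hN : IsNeck Q k N) (D : OrientedDecomposition Q k N)
    (h : IsFrame Q ν w) (hdim : Module.finrank ℝ V = (k + 1) + 1)
    (hNν : ∀ x ∈ N, bil Q ν x = 0) :
    energy Q D.enclosedVolume = unitBallVolume (k + 1) ^ 2 := by
  have hdom : ∀ i, ∀ s ∈ coneDomain (D.piece i), Fin.tail s ∈ D.dom i := fun i s hs =>
    D.closure_subset i (subset_closure hs.2)
  have hmem : ∀ i, ∀ s ∈ coneDomain (D.piece i), D.chart i (Fin.tail s) ∈ N := fun i s hs =>
    (D.isLocalParam i).mem (hdom i s hs)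
  have key : ∀ i j, ∀ s ∈ coneDomain (D.piece i), ∀ s' ∈ coneDomain (D.piece j),
      proj Q w (coneMap (D.chart i) s) = proj Q w (coneMap (D.chart j) s') →
      s 0 = s' 0 ∧ D.chart i (Fin.tail s) = D.chart j (Fin.tail s') := fun i j s hs s' hs' hss =>
    h.smul_eq_smul hdim hs.1.1 hs'.1.1 (hN.subset (hmem i s hs)) (hN.subset (hmem j s' hs'))
      (hNν _ (hmem i s hs)) (hNν _ (hmem j s' hs')) hss
  have hzero : ∀ j, wedgeDet (h.basis hdim) (w j) D.enclosedVolume = 0 := by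
    intro j
    rw [enclosedVolume, map_sum]
    refine Finset.sum_eq_zero fun i _ => ?_
    rw [apply_units_smul, ((D.isLocalParam i).apply_directedVolume_coneMap (D.isCompact_closure i)
      (D.closure_subset i) (wedgeDet (h.basis hdim) (w j))).2,
      setIntegral_eq_zero_of_forall_eq_zero, mul_zero]
    intro s hs
    apply h.wedgeDet_eq_zero hdim
    intro l
    rw [(D.isLocalParam i).partialDeriv_coneMap (hdom i s hs)]
    refine Fin.cases ?_ (fun l => ?_) l
    · exact hNν _ (hmem i s hs)
    · rw [Fin.cons_succ, map_smul]
      have : bil Q ν (partialDeriv (D.chart i) (Fin.tail s) l) = 0 :=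
        (D.isLocalParam i).fderiv_mem (W := LinearMap.ker (bil Q ν)) hNν (hdom i s hs) _
      rw [this, smul_zero]
  rw [h.energy_eq_sq hdim hzero, ← sq_abs]
  congr 1
  have hvol := (D.volume_projCone_le h hdim hN.subset hN.spacelike).2 (fun i s hs s' hs' hss => by
      obtain ⟨h0, hc⟩ := key i i s hs s' hs' hss
      rw [← Fin.cons_self_tail s, ← Fin.cons_self_tail s', h0,
        (D.isLocalParam i).injOn (hdom i s hs) (hdom i s' hs') hc])
    (fun i j hij => by
      refine Set.disjoint_left.2 ?_
      rintro _ ⟨s, hs, rfl⟩ ⟨s', hs', hss⟩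
      obtain ⟨-, hc⟩ := key i j s hs s' hs' hss.symm
      exact Set.disjoint_left.1 (D.disjoint hij) ⟨_, hs.2, rfl⟩ ⟨_, hs'.2, hc.symm⟩)
  rw [hN.volume_projCone_eq h hdim hNν,
    ENNReal.ofReal_eq_ofReal_iff (unitBallVolume_pos k).le (abs_nonneg _)] at hvol
  exact hvol.symm

/-- In the converse W is not assumed spacelike; this is deduced from the neck it contains. -/
theorem energy_eq_iff (hN : IsNeck Q k N) (D : OrientedDecomposition Q k N)
    (h : IsFrame Q ν w) (hdim : Module.finrank ℝ V = (k + 1) + 1) :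
    energy Q D.enclosedVolume = unitBallVolume (k + 1) ^ 2 ↔
      ∃ W : Submodule ℝ V, Module.finrank ℝ W = k + 1 ∧ N = ↑W ∩ hyperboloid Q := by
  constructor
  · intro heq
    obtain ⟨a, ha, hNa⟩ := (D.sq_le_energy hN h hdim).2 heq
    exact ⟨_, finrank_ker_bil hdim ha, hNa⟩
  · rintro ⟨W, hW, hNW⟩
    have hsub : N ⊆ W := by rw [hNW]; exact inter_subset_left
    have hν : Q ν < 0 := by rw [← bil_self, h.timelike]; norm_num
    obtain ⟨a, u, hau, hWa⟩ := exists_frame_of_spacelike hdim hν W hW (hN.pos_of_subset h hW hsub)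
    exact D.energy_eq_of_subset hN hau hdim fun x hx => (hWa x).1 (hsub hx)

end OrientedDecomposition

end Surround

/-! ### Existence of oriented decompositions -/

section Existence

open Topology

variable {N : Set V}

theorem IsLocalParam.mono {φ : (Fin k → ℝ) → V} {U U' : Set (Fin k → ℝ)}
    (hφ : IsLocalParam N φ U) (hU' : IsOpen U') (hsub : U' ⊆ U) : IsLocalParam N φ U' where
  isOpen_dom := hU'
  contDiffOn := hφ.contDiffOn.mono hsub
  immersion u hu := hφ.immersion u (hsub hu)
  isEmbedding := hφ.isEmbedding.comp (IsEmbedding.inclusion hsub)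
  isOpen_image := by
    obtain ⟨O, hO, hOim⟩ := hφ.isOpen_image
    obtain ⟨O', hO', hO'im⟩ := hφ.isEmbedding.isInducing.isOpen_iff.1
      (hU'.preimage (continuous_subtype_val (p := fun u => u ∈ U)))
    have hmem : ∀ u (hu : u ∈ U), φ u ∈ O' ↔ u ∈ U' := fun u hu =>
      Set.ext_iff.1 hO'im ⟨u, hu⟩
    refine ⟨O ∩ O', hO.inter hO', ?_⟩
    rw [← inter_assoc, ← hOim]
    ext x
    constructor
    · rintro ⟨u, hu, rfl⟩
      exact ⟨⟨u, hsub hu, rfl⟩, (hmem u (hsub hu)).2 hu⟩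
    · rintro ⟨⟨u, hu, rfl⟩, hx⟩
      exact ⟨u, (hmem u hu).1 hx, rfl⟩

theorem exists_unit_mul_pos {X : Type*} [TopologicalSpace X] {S : Set X} (hS : IsPreconnected S)
    {f : X → ℝ} (hf : ContinuousOn f S) (h0 : ∀ x ∈ S, f x ≠ 0) :
    ∃ e : ℤˣ, ∀ x ∈ S, 0 < ((e : ℤ) : ℝ) * f x := by
  by_cases hpos : ∀ x ∈ S, 0 < f x
  · exact ⟨1, fun x hx => by simpa using hpos x hx⟩
  · push Not at hpos
    obtain ⟨a, ha, hfa⟩ := hpos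
    refine ⟨-1, fun x hx => ?_⟩
    by_contra hcon
    have hfx : 0 ≤ f x := by simpa using hcon
    obtain ⟨c, hc, hfc⟩ := hS.intermediate_value ha hx hf ⟨hfa, hfx⟩
    exact h0 c hc hfc

variable [FiniteDimensional ℝ V] {ν : V} {w : Fin (k + 1) → V}

theorem IsLocalParam.continuousOn_coneTensor {φ : (Fin k → ℝ) → V} {U : Set (Fin k → ℝ)}
    (hφ : IsLocalParam N φ U) (L : (⋀[ℝ]^(k + 1) V) →ₗ[ℝ] ℝ) :
    ContinuousOn (fun u => L (coneTensor φ u)) U := by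
  have h1 : ContinuousOn (fun u => (Fin.cons (φ u) (partialDeriv φ u) : Fin (k + 1) → V)) U :=
    ContinuousOn.finCons hφ.contDiffOn.continuousOn
      (continuousOn_partialDeriv hφ.isOpen_dom hφ.contDiffOn)
  exact (continuous_alternatingMap
    (L.compAlternatingMap (exteriorPower.ιMulti ℝ (k + 1)))).comp_continuousOn h1

/-- Around each point of a neck there is a parametrization on a ball together with a sign that makes
it compatible with the orientation of a fixed frame. -/
theorem IsNeck.exists_chart (hN : IsNeck Q k N) (h : IsFrame Q ν w)
    (hdim : Module.finrank ℝ V = (k + 1) + 1) {x : V} (hx : x ∈ N) :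
    ∃ (φ : (Fin k → ℝ) → V) (U B : Set (Fin k → ℝ)) (O : Set V) (e : ℤˣ), IsLocalParam N φ U ∧
      IsOpen B ∧ IsCompact (closure B) ∧ closure B ⊆ U ∧ IsOpen O ∧ φ '' B = N ∩ O ∧ x ∈ O ∧
      ∀ u ∈ U, 0 < ((e : ℤ) : ℝ) *
        extInner Q (k + 1) (coneTensor φ u) (exteriorPower.ιMulti ℝ (k + 1) w) := by
  obtain ⟨φ, U₀, hφ₀, u, hu, rfl⟩ := hN.submanifold.2 x hx
  -- The chart lives on the ball of radius r and the piece on that of radius r/2, leaving room for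
  -- its closure. Connectedness of the larger ball fixes the sign.
  obtain ⟨r, hr, hrU⟩ := Metric.isOpen_iff.1 hφ₀.isOpen_dom u hu
  have hφ := hφ₀.mono Metric.isOpen_ball hrU
  have hcl : closure (Metric.ball u (r / 2)) ⊆ Metric.closedBall u (r / 2) :=
    Metric.closure_ball_subset_closedBall
  have hsub : closure (Metric.ball u (r / 2)) ⊆ Metric.ball u r :=
    hcl.trans (Metric.closedBall_subset_ball (half_lt_self hr))
  obtain ⟨O, hO, hOim⟩ := (hφ.mono Metric.isOpen_ball (subset_closure.trans hsub)).isOpen_image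
  obtain ⟨e, he⟩ := exists_unit_mul_pos (convex_ball u r).isPreconnected
    (hφ.continuousOn_coneTensor
      ((extInner Q (k + 1)).flip (exteriorPower.ιMulti ℝ (k + 1) w))) (fun v hv h0 => by
        have hc := hφ.energy_coneTensor_pos hN.subset hN.spacelike hv
        have := h.extInner_trans hdim (by rw [h.energy_frame]; exact one_pos) hc hc
        rw [LinearMap.flip_apply] at h0
        rw [h0] at this
        simp at this)
  refine ⟨φ, _, _, O, e, hφ, Metric.isOpen_ball,
    (isCompact_closedBall u (r / 2)).of_isClosed_subset isClosed_closure hcl, hsub, hO,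
    hOim, ?_, he⟩
  exact (hOim.subset ⟨u, Metric.mem_ball_self (half_pos hr), rfl⟩).2

theorem exists_first {m : ℕ} {X : Type*} {O : Fin m → Set X} {x : X} (hx : ∃ i, x ∈ O i) :
    ∃ i, x ∈ O i ∧ ∀ j < i, x ∉ O j := by
  obtain ⟨i, hi, hmin⟩ := WellFounded.has_min (wellFounded_lt (α := Fin m)) {i | x ∈ O i} hx
  exact ⟨i, hi, fun j hj hxj => hmin j hxj hj⟩

/-- Take a finite subcover by charts and remove from each piece what earlier charts cover. Signs
chosen against one fixed frame are mutually compatible by `extInner_trans`. -/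
theorem IsNeck.nonempty_orientedDecomposition (hN : IsNeck Q k N) (h : IsFrame Q ν w)
    (hdim : Module.finrank ℝ V = (k + 1) + 1) : Nonempty (OrientedDecomposition Q k N) := by
  choose φ U B O e hφ hB hBc hBU hO hOim hxO he using
    fun x : N => hN.exists_chart h hdim x.2
  obtain ⟨t, ht⟩ := hN.submanifold.1.elim_nhds_subcover' (fun x hx => O ⟨x, hx⟩)
    (fun x hx => (hO ⟨x, hx⟩).mem_nhds (hxO ⟨x, hx⟩))
  set c : Fin t.card → N := fun i => (t.equivFin.symm i : N)
  have hcover : ∀ x ∈ N, ∃ i, x ∈ O (c i) := by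
    intro x hx
    obtain ⟨z, hz, hxz⟩ := mem_iUnion₂.1 (ht hx)
    exact ⟨t.equivFin ⟨z, hz⟩, by simpa [c] using hxz⟩
  set A : Fin t.card → Set (Fin k → ℝ) := fun i =>
    B (c i) \ ⋃ j ∈ Iio i, B (c i) ∩ φ (c i) ⁻¹' O (c j) with hA
  have hAB : ∀ i, A i ⊆ B (c i) := fun i => sdiff_subset
  have hnot : ∀ i j, j < i → ∀ u ∈ A i, φ (c i) u ∉ O (c j) := by
    intro i j hj u hu hmem
    exact hu.2 (mem_iUnion₂.2 ⟨j, hj, hu.1, hmem⟩)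
  have hmemO : ∀ i, ∀ u ∈ A i, φ (c i) u ∈ O (c i) := fun i u hu =>
    ((hOim (c i)).subset ⟨u, hAB i hu, rfl⟩).2
  have hdisj : ∀ i j, j < i → Disjoint (φ (c i) '' A i) (φ (c j) '' A j) := by
    intro i j hj
    rw [Set.disjoint_left]
    rintro _ ⟨u, hu, rfl⟩ ⟨v, hv, hvu⟩
    exact hnot i j hj u hu (hvu ▸ hmemO j v hv)
  refine ⟨{ size := t.card
            chart := fun i => φ (c i)
            dom := fun i => U (c i)
            isLocalParam := fun i => hφ (c i)
            piece := A
            measurableSet_piece := fun i => ?_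
            isCompact_closure := fun i => (hBc (c i)).of_isClosed_subset isClosed_closure
              (closure_mono (hAB i))
            closure_subset := fun i => (closure_mono (hAB i)).trans (hBU (c i))
            disjoint := fun i j hij => ?_
            cover := ?_
            sgn := fun i => e (c i)
            oriented := fun i j u hu v hv => ?_ }⟩
  · refine (hB (c i)).measurableSet.diff (MeasurableSet.biUnion (to_countable _) fun j _ => ?_)
    exact (((hφ (c i)).contDiffOn.continuousOn.mono
      (subset_closure.trans (hBU (c i)))).isOpen_inter_preimage (hB (c i))
        (hO (c j))).measurableSet
  · rcases lt_or_gt_of_ne hij with hlt | hlt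
    · exact (hdisj j i hlt).symm
    · exact hdisj i j hlt
  · refine Subset.antisymm (iUnion_subset fun i => ?_) fun x hx => ?_
    · rintro _ ⟨u, hu, rfl⟩
      exact ((hOim (c i)).subset ⟨u, hAB i hu, rfl⟩).1
    · obtain ⟨i, hi, hmin⟩ := exists_first (O := fun i => O (c i)) (hcover x hx)
      obtain ⟨u, hu, rfl⟩ := (hOim (c i)).superset ⟨hx, hi⟩
      refine mem_iUnion.2 ⟨i, u, ⟨hu, fun hmem => ?_⟩, rfl⟩
      obtain ⟨j, hj, -, hO⟩ := mem_iUnion₂.1 hmem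
      exact hmin j hj hO
  · rw [apply_units_smul, ← LinearMap.flip_apply, apply_units_smul, LinearMap.flip_apply]
    have h1 := h.extInner_trans hdim (by rw [h.energy_frame]; exact one_pos)
      ((hφ (c i)).energy_coneTensor_pos hN.subset hN.spacelike hu)
      ((hφ (c j)).energy_coneTensor_pos hN.subset hN.spacelike hv)
    have h2 := mul_pos (he (c i) u hu) (he (c j) v hv)
    have h3 := mul_pos h1 h2
    set p := extInner Q (k + 1) (coneTensor (φ (c i)) u) (exteriorPower.ιMulti ℝ (k + 1) w)
    set q := extInner Q (k + 1) (coneTensor (φ (c j)) v) (exteriorPower.ιMulti ℝ (k + 1) w)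
    refine pos_of_mul_pos_right (a := (p * q) ^ 2) ?_ (sq_nonneg _)
    refine h3.trans_le (le_of_eq ?_)
    ring

end Existence

/-! ### Spacelike sections of the hyperboloid are necks -/

section Section

/-- The linear map sending the standard basis of Euclidean space to `w`. -/
def embed (w : Fin (k + 1) → V) : EuclideanSpace ℝ (Fin (k + 1)) →L[ℝ] V :=
  ∑ j, (EuclideanSpace.proj j : EuclideanSpace ℝ (Fin (k + 1)) →L[ℝ] ℝ).smulRight (w j)

theorem embed_apply (w : Fin (k + 1) → V) (y : EuclideanSpace ℝ (Fin (k + 1))) :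
    embed w y = ∑ j, y j • w j := by
  simp [embed]

variable {ν : V} {w : Fin (k + 1) → V}

theorem IsFrame.bil_embed (h : IsFrame Q ν w) (y : EuclideanSpace ℝ (Fin (k + 1))) :
    bil Q ν (embed w y) = 0 := by
  rw [embed_apply]; simp [h.orth]

theorem IsFrame.pos_of_mem_ker (h : IsFrame Q ν w) (hdim : Module.finrank ℝ V = (k + 1) + 1)
    {x : V} (hx : bil Q ν x = 0) (hx0 : x ≠ 0) : 0 < Q x := by
  rw [h.apply_eq hdim, hx]
  have hnn : 0 ≤ ∑ j, bil Q (w j) x ^ 2 := Finset.sum_nonneg fun _ _ => sq_nonneg _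
  rcases hnn.eq_or_lt with h0 | h0
  · rw [eq_comm, Finset.sum_eq_zero_iff_of_nonneg fun _ _ => sq_nonneg _] at h0
    exact absurd (h.eq_zero hdim hx fun j => by simpa using h0 j (Finset.mem_univ j)) hx0
  · simpa using h0

/-- The deformation of the hyperboloid to a spacelike section. -/
def deform (Q : QuadraticForm ℝ V) (ν : V) (s : ℝ) (x : V) : V :=
  (Real.sqrt (1 + (s * bil Q ν x) ^ 2) / Real.sqrt (1 + bil Q ν x ^ 2)) • (x + bil Q ν x • ν) -
    (s * bil Q ν x) • ν

theorem bil_deform (hν : bil Q ν ν = -1) (s : ℝ) (x : V) :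
    bil Q ν (deform Q ν s x) = s * bil Q ν x := by
  simp only [deform, map_sub, map_add, map_smul, hν, smul_eq_mul]
  ring

/-- With τ = ⟨ν, x⟩, the spacelike part x + τν has squared length 1 + τ². Once τ becomes sτ, the
scaling factor makes it 1 + (sτ)², as the hyperboloid requires. -/
theorem deform_mem (hν : bil Q ν ν = -1) (s : ℝ) {x : V} (hx : x ∈ hyperboloid Q) :
    deform Q ν s x ∈ hyperboloid Q := by
  have hx1 : bil Q x x = 1 := by rw [bil_self]; exact hx
  change Q _ = 1
  rw [← bil_self]
  have ha := Real.sq_sqrt (show 0 ≤ 1 + (s * bil Q ν x) ^ 2 by positivity)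
  have hb := Real.sq_sqrt (show 0 ≤ 1 + bil Q ν x ^ 2 by positivity)
  have hb0 := Real.sqrt_pos.2 (show 0 < 1 + bil Q ν x ^ 2 by positivity)
  simp only [deform, map_sub, map_add, map_smul, LinearMap.sub_apply, LinearMap.add_apply,
    LinearMap.smul_apply, hν, hx1, smul_eq_mul, bil_comm Q x ν]
  set a := Real.sqrt (1 + (s * bil Q ν x) ^ 2)
  set b := Real.sqrt (1 + bil Q ν x ^ 2)
  set τ := bil Q ν x
  have : (a / b) ^ 2 * (1 + τ ^ 2) = a ^ 2 := by rw [← hb]; field_simp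
  linear_combination this + ha

theorem deform_one (x : V) : deform Q ν 1 x = x := by
  have hb0 := Real.sqrt_pos.2 (show 0 < 1 + bil Q ν x ^ 2 by positivity)
  rw [deform, one_mul, div_self hb0.ne', one_smul, add_sub_cancel_right]

theorem deform_zero_of_mem {x : V} (hx : bil Q ν x = 0) (s : ℝ) : deform Q ν s x = x := by
  simp [deform, hx]

theorem deform_zero_mem (hν : bil Q ν ν = -1) {x : V} (hx : x ∈ hyperboloid Q) :
    deform Q ν 0 x ∈ (↑(LinearMap.ker (bil Q ν)) ∩ hyperboloid Q : Set V) := by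
  refine ⟨?_, deform_mem hν 0 hx⟩
  change bil Q ν _ = 0
  rw [bil_deform hν, zero_mul]

variable [FiniteDimensional ℝ V]

/-- The orthogonal projection with values in Euclidean space. -/
def euclideanProj (Q : QuadraticForm ℝ V) (w : Fin (k + 1) → V) :
    V →L[ℝ] EuclideanSpace ℝ (Fin (k + 1)) :=
  ((EuclideanSpace.equiv (Fin (k + 1)) ℝ).symm : (Fin (k + 1) → ℝ) →L[ℝ] _).comp (proj Q w)

theorem euclideanProj_apply (x : V) (j : Fin (k + 1)) :
    euclideanProj Q w x j = bil Q (w j) x := rfl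

theorem IsFrame.euclideanProj_embed (h : IsFrame Q ν w) (y : EuclideanSpace ℝ (Fin (k + 1))) :
    euclideanProj Q w (embed w y) = y := by
  ext j
  rw [euclideanProj_apply, embed_apply]
  simp [h.gram]

theorem IsFrame.embed_euclideanProj (h : IsFrame Q ν w)
    (hdim : Module.finrank ℝ V = (k + 1) + 1) (x : V) :
    embed w (euclideanProj Q w x) = x + bil Q ν x • ν := by
  conv_rhs => enter [1]; rw [h.expand hdim x]
  rw [embed_apply]
  simp only [euclideanProj_apply]
  module

theorem IsFrame.apply_embed (h : IsFrame Q ν w)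
    (hdim : Module.finrank ℝ V = (k + 1) + 1) (y : EuclideanSpace ℝ (Fin (k + 1))) :
    Q (embed w y) = ‖y‖ ^ 2 := by
  rw [h.apply_eq hdim, h.bil_embed, EuclideanSpace.real_norm_sq_eq]
  simp only [← euclideanProj_apply, h.euclideanProj_embed]
  simp

theorem IsFrame.image_sphere (h : IsFrame Q ν w) (hdim : Module.finrank ℝ V = (k + 1) + 1) :
    embed w '' Metric.sphere 0 1 = ↑(LinearMap.ker (bil Q ν)) ∩ hyperboloid Q := by
  ext x
  constructor
  · rintro ⟨y, hy, rfl⟩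
    refine ⟨h.bil_embed y, ?_⟩
    have : ‖y‖ = 1 := by simpa using hy
    change Q (embed w y) = 1
    rw [h.apply_embed hdim, this, one_pow]
  · rintro ⟨hx, hxH⟩
    have hx' : bil Q ν x = 0 := hx
    have hxe : embed w (euclideanProj Q w x) = x := by
      rw [h.embed_euclideanProj hdim, hx', zero_smul, add_zero]
    refine ⟨euclideanProj Q w x, ?_, hxe⟩
    have h1 := h.apply_embed hdim (euclideanProj Q w x)
    have h2 : Q x = 1 := hxH
    rw [hxe, h2] at h1
    rw [mem_sphere_zero_iff_norm]
    nlinarith [norm_nonneg (euclideanProj Q w x)]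

/-- Inverse stereographic projection from the pole v, carried to V by `embed w`. It is an immersion
because projecting back and applying stereographic projection is a differentiable left inverse. -/
theorem exists_stereographic_param (h : IsFrame Q ν w) (hdim : Module.finrank ℝ V = (k + 1) + 1)
    {v : EuclideanSpace ℝ (Fin (k + 1))} (hv : ‖v‖ = 1) :
    ∃ φ : (Fin k → ℝ) → V,
      IsLocalParam (↑(LinearMap.ker (bil Q ν)) ∩ hyperboloid Q) φ univ ∧
      φ '' univ = (↑(LinearMap.ker (bil Q ν)) ∩ hyperboloid Q) ∩ {embed w v}ᶜ := by
  have hfact : Fact (Module.finrank ℝ (EuclideanSpace ℝ (Fin (k + 1))) = k + 1) := ⟨by simp⟩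
  have hv0 : v ≠ 0 := by rintro rfl; simp at hv
  let L : (Fin k → ℝ) ≃L[ℝ] (Submodule.span ℝ {v})ᗮ := ContinuousLinearEquiv.ofFinrankEq
    (by rw [Submodule.finrank_orthogonal_span_singleton (n := k) hv0]; simp)
  let φ : (Fin k → ℝ) → V := fun u => embed w (stereoInvFunAux v (L u))
  have hinj : Function.Injective (embed w) :=
    Function.LeftInverse.injective (g := euclideanProj Q w) h.euclideanProj_embed
  have hval : ∀ u, φ u = embed w ((stereographic hv).symm (L u) : EuclideanSpace ℝ (Fin (k + 1))) :=
    fun _ => rfl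
  have himage : φ '' univ =
      (↑(LinearMap.ker (bil Q ν)) ∩ hyperboloid Q) ∩ {embed w v}ᶜ := by
    rw [← h.image_sphere hdim]
    have hr := range_stereographic_symm hv (by simpa using hv)
    ext x
    constructor
    · rintro ⟨u, -, rfl⟩
      have hm := hr.subset (mem_range_self (L u))
      rw [hval]
      refine ⟨mem_image_of_mem _ (Subtype.property _), fun heq => hm ?_⟩
      exact Subtype.ext (hinj heq)
    · rintro ⟨⟨y, hy, rfl⟩, hne⟩
      have hm : (⟨y, hy⟩ : Metric.sphere (0 : EuclideanSpace ℝ (Fin (k + 1))) 1) ∈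
          range (stereographic hv).symm := by
        rw [hr]
        intro heq
        have heq' : y = v := congrArg Subtype.val heq
        exact hne (congrArg (embed w) heq')
      obtain ⟨z, hz⟩ := hm
      refine ⟨L.symm z, mem_univ _, ?_⟩
      rw [hval, L.apply_symm_apply, hz]
  have hcd : ContDiff ℝ 1 φ := (embed w).contDiff.comp (contDiff_stereoInvFunAux.comp
    (((Submodule.span ℝ {v})ᗮ.subtypeL.comp (L : (Fin k → ℝ) →L[ℝ] _)).contDiff))
  refine ⟨φ, ⟨isOpen_univ, hcd.contDiffOn, fun u _ => ?_, ?_, {embed w v}ᶜ,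
    isOpen_compl_singleton, himage⟩, himage⟩
  -- Stereographic projection is smooth only off this hyperplane, which touches the sphere just at
  -- the pole.
  · have hne : innerSL ℝ v (stereoInvFunAux v (L u)) ≠ 1 := by
      intro h1
      have h2 := (inner_eq_one_iff_of_norm_eq_one (𝕜 := ℝ) hv
        (by simpa using (stereoInvFun hv (L u)).2)).1 h1
      exact stereoInvFun_ne_north_pole hv (L u) (Subtype.ext h2.symm)
    have hopen : IsOpen {x : EuclideanSpace ℝ (Fin (k + 1)) | innerSL ℝ v x ≠ 1} :=
      isOpen_ne_fun (innerSL ℝ v).continuous continuous_const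
    have hd1 : DifferentiableAt ℝ (stereoToFun v) (euclideanProj Q w (φ u)) := by
      rw [h.euclideanProj_embed]
      exact (contDiffOn_stereoToFun.contDiffAt (hopen.mem_nhds hne)).differentiableAt one_ne_zero
    have hd2 : DifferentiableAt ℝ (fun x => L.symm (stereoToFun v (euclideanProj Q w x))) (φ u) :=
      L.symm.differentiableAt.comp _ (hd1.comp _ (euclideanProj Q w).differentiableAt)
    have hid : (fun u => L.symm (stereoToFun v (euclideanProj Q w (φ u)))) = id := by
      funext u
      rw [h.euclideanProj_embed]
      have := stereo_right_inv hv (L u)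
      exact (congrArg L.symm this).trans (L.symm_apply_apply u)
    have hd3 := hd2.hasFDerivAt.comp u (hcd.differentiable one_ne_zero u).hasFDerivAt
    have hd4 : HasFDerivAt (fun u => L.symm (stereoToFun v (euclideanProj Q w (φ u))))
        (ContinuousLinearMap.id ℝ (Fin k → ℝ)) u := by
      rw [hid]; exact hasFDerivAt_id u
    have heq := hd3.unique hd4
    exact Function.LeftInverse.injective fun a => congrArg (fun T => T a) heq
  · have hemb : Topology.IsEmbedding (embed w) :=
      (LinearMap.isClosedEmbedding_of_injective (f := (embed w).toLinearMap)
        (LinearMap.ker_eq_bot.2 hinj)).isEmbedding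
    exact hemb.comp (Topology.IsEmbedding.subtypeVal.comp
      ((isOpenEmbedding_stereographic_symm hv).isEmbedding.comp
        (L.toHomeomorph.isEmbedding.comp Topology.IsEmbedding.subtypeVal)))

theorem isSpacelike_of_subset {N : Set V} {W : Submodule ℝ V} (hNW : N ⊆ W)
    (hpos : ∀ x ∈ W, x ≠ 0 → 0 < Q x) : IsSpacelike Q k N := by
  intro φ U hφ u hu v hv
  refine hpos _ (hφ.fderiv_mem hNW hu v) fun h0 => hv ?_
  exact hφ.immersion u hu (h0.trans (map_zero _).symm)

theorem continuous_deform (Q : QuadraticForm ℝ V) (ν : V) :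
    Continuous fun p : ℝ × V => deform Q ν p.1 p.2 := by
  have h1 : Continuous fun p : ℝ × V => bil Q ν p.2 :=
    (bil Q ν).continuous_of_finiteDimensional.comp continuous_snd
  have h2 : ∀ p : ℝ × V, Real.sqrt (1 + bil Q ν p.2 ^ 2) ≠ 0 := fun p =>
    (Real.sqrt_pos.2 (by positivity)).ne'
  have h3 : Continuous fun p : ℝ × V =>
      Real.sqrt (1 + (p.1 * bil Q ν p.2) ^ 2) / Real.sqrt (1 + bil Q ν p.2 ^ 2) :=
    Continuous.div (by fun_prop) (by fun_prop) h2
  exact (h3.smul (continuous_snd.add (h1.smul continuous_const))).sub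
    ((continuous_fst.mul h1).smul continuous_const)

/-- The retraction of the hyperboloid to a spacelike section. -/
def retraction (hν : bil Q ν ν = -1) :
    C(hyperboloid Q, (↑(LinearMap.ker (bil Q ν)) ∩ hyperboloid Q : Set V)) where
  toFun x := ⟨deform Q ν 0 x, deform_zero_mem hν x.2⟩
  continuous_toFun := Continuous.subtype_mk
    ((continuous_deform Q ν).comp (continuous_const.prodMk continuous_subtype_val)) _

/-- `deform` runs from the retraction at s = 0 to the identity at s = 1, and the retraction fixes
the section pointwise. -/
theorem exists_homotopyEquiv (hν : bil Q ν ν = -1)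
    (hsub : (↑(LinearMap.ker (bil Q ν)) ∩ hyperboloid Q : Set V) ⊆ hyperboloid Q) :
    ∃ e : ContinuousMap.HomotopyEquiv
        (↑(LinearMap.ker (bil Q ν)) ∩ hyperboloid Q : Set V) (hyperboloid Q),
      ∀ x, e x = Set.inclusion hsub x := by
  have hleft : (retraction hν).comp ⟨Set.inclusion hsub, continuous_inclusion hsub⟩ =
      ContinuousMap.id _ := by
    ext x
    exact deform_zero_of_mem x.2.1 0
  have hright : ContinuousMap.Homotopic
      (ContinuousMap.comp ⟨Set.inclusion hsub, continuous_inclusion hsub⟩ (retraction hν))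
      (ContinuousMap.id (hyperboloid Q)) :=
    ⟨{ toFun := fun p => ⟨deform Q ν p.1 p.2, deform_mem hν _ p.2.2⟩
       continuous_toFun := Continuous.subtype_mk ((continuous_deform Q ν).comp
        ((continuous_subtype_val.comp continuous_fst).prodMk
          (continuous_subtype_val.comp continuous_snd))) _
       map_zero_left := fun x => rfl
       map_one_left := fun x => Subtype.ext (deform_one (x : V)) }⟩
  exact ⟨⟨⟨Set.inclusion hsub, continuous_inclusion hsub⟩, retraction hν, by rw [hleft], hright⟩,
    fun x => rfl⟩

theorem IsFrame.isNeck_inter (h : IsFrame Q ν w) (hdim : Module.finrank ℝ V = (k + 1) + 1) :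
    IsNeck Q k (↑(LinearMap.ker (bil Q ν)) ∩ hyperboloid Q) where
  submanifold := by
    refine ⟨?_, fun x hx => ?_⟩
    · rw [← h.image_sphere hdim]
      exact (isCompact_sphere _ _).image (embed w).continuous
    · obtain ⟨y, hy, rfl⟩ := (h.image_sphere hdim).superset hx
      have hy1 : ‖y‖ = 1 := by simpa using hy
      -- Projecting from the antipode puts the given point inside the chart.
      obtain ⟨φ, hφ, him⟩ := exists_stereographic_param h hdim (v := -y) (by simpa using hy1)
      refine ⟨φ, univ, hφ, him.superset ⟨hx, fun heq => ?_⟩⟩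
      have h1 : y = -y := by
        have := congrArg (euclideanProj Q w) heq
        rwa [h.euclideanProj_embed, h.euclideanProj_embed] at this
      have h2 : (2 : ℝ) • y = 0 := by
        rw [two_smul]; nth_rw 2 [h1]; exact add_neg_cancel y
      rw [(smul_eq_zero.1 h2).resolve_left two_ne_zero, norm_zero] at hy1
      exact zero_ne_one hy1
  spacelike := isSpacelike_of_subset (W := LinearMap.ker (bil Q ν)) inter_subset_left
    fun _ hx hx0 => h.pos_of_mem_ker hdim hx hx0
  subset := inter_subset_right
  homotopyEquiv := exists_homotopyEquiv h.timelike _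

end Section

end Bottleneck

end

/-! ### The main theorem -/

theorem mainTheorem2 {V : Type*} [NormedAddCommGroup V] [NormedSpace ℝ V] [FiniteDimensional ℝ V]
    (k : ℕ) (Q : QuadraticForm ℝ V) (hdim : Module.finrank ℝ V = (k + 1) + 1)
    (hpos : sigPos Q = k + 1) (hneg : sigNeg Q = 1) :
    (∀ W : Submodule ℝ V, Module.finrank ℝ W = k + 1 → (∀ x ∈ W, x ≠ 0 → 0 < Q x) →
      Bottleneck.IsNeck Q k (↑W ∩ Bottleneck.hyperboloid Q)) ∧
    ∀ N : Set V, Bottleneck.IsNeck Q k N →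
      Nonempty (Bottleneck.OrientedDecomposition Q k N) ∧
      ∀ D : Bottleneck.OrientedDecomposition Q k N,
        Bottleneck.unitBallVolume (k + 1) ^ 2 ≤ Bottleneck.energy Q D.enclosedVolume ∧
        (Bottleneck.energy Q D.enclosedVolume = Bottleneck.unitBallVolume (k + 1) ^ 2 ↔
          ∃ W : Submodule ℝ V, Module.finrank ℝ W = k + 1 ∧
            N = ↑W ∩ Bottleneck.hyperboloid Q) := by
  obtain ⟨ν, w, h⟩ := Bottleneck.exists_frame hdim hpos hneg
  refine ⟨fun W hW hWpos => ?_, fun N hN => ⟨hN.nonempty_orientedDecomposition h hdim, fun D =>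
    ⟨(D.sq_le_energy hN h hdim).1, D.energy_eq_iff hN h hdim⟩⟩⟩
  have hν : Q ν < 0 := by rw [← Bottleneck.bil_self, h.timelike]; norm_num
  obtain ⟨a, u, hau, hWa⟩ := Bottleneck.exists_frame_of_spacelike hdim hν W hW hWpos
  have : W = LinearMap.ker (Bottleneck.bil Q a) := Submodule.ext hWa
  rw [this]
  exact hau.isNeck_inter hdim
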